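/- \textbf{Setting.} Let $(E_j,\mathcal E_j)$, $j=1,2,3$, be Borel spaces (measurably isomorphic to a Borel subset of $[0,1]$), with distinguished points $o_j\in E_j$. Put $E_j^o=E_j\setminus\{o_j\}$ and $E_{123}^o=(E_1\times E_2\times E_3)\setminus\{(o_1,o_2,o_3)\}$, with the trace $\sigma$-fields. For each $j$ let $L_{0,j}\subset L_{1,j}\subset\cdots$ be measurable sets with union $E_j^o$. Let $\Lambda$ be a measure on $E_{123}^o$ that is locally finite, i.e. for every $h$ it is finite on \[ (L_{h,1}\times E_2\times E_3)\cup(E_1\times L_{h,2}\times E_3)\cup(E_1\times E_2\times L_{h,3}), \] and suppose that $\Lambda(E_{123}^o)=\infty$ and \[ \Lambda(y_1=o_1,\,y_3=o_3)\in\{0,\infty\},\qquad \Lambda(y_2=o_2,\,y_3=o_3)\in\{0,\infty\},\qquad \Lambda(y_3=o_3)\in\{0,\infty\}. \] Let $\Lambda_3^o(A)=\Lambda(y_3\in A)$, for measurable $A\subset E_3^o$, and let $\Lambda_{12\mid 3^o}$ be a probability kernel from $E_3^o$ to $E_1\times E_2$ with \[ \Lambda(A)=\int_{E_3^o}\int \mathbf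 1_A(y_1,y_2,y_3)\,\Lambda_{12\mid 3^o}(dy_1dy_2\mid y_3)\,\Lambda_3^o(dy_3),\qquad A\in\mathcal E_1\otimes\mathcal E_2\otimes\mathcal E_3^o , \] with marginal kernels $\Lambda_{1\mid 3^o}=\Lambda_{12\mid 3^o}(\cdot\times E_2\mid\cdot)$ and $\Lambda_{2\mid 3^o}=\Lambda_{12\mid 3^o}(E_1\times\cdot\mid\cdot)$. Define a measure on $E_{123}^o$ by \[ \Lambda^\perp_{12;3}(A)=\Lambda\big(A\cap\{y_2=o_2,y_3=o_3\}\big)+\Lambda\big(A\cap\{y_1=o_1,y_3=o_3\}\big)+\Lambda_3^o\big(\{y_3:(o_1,o_2,y_3)\in A\}\big). \] A Poisson point process with mean measure $M$ is a random $\{0,1,\dots,\infty\}$-valued $s$-finite measure $N$ such that $N(A)$ is Poisson with mean $M(A)\in[0,\infty]$ for each measurable $A$, and such that $N(A_1),\dots,N(A_m)$ are independent for disjoint measurable $A_1,\dots,A_m$. Let $\xi$ be a Poisson point process on $E_{123}^o$ with mean measure $\Lambda$, and let $\xi_j(A)=\xi(y_j\in A)$, $A\in\mathcal E_j$, be its projections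 to the (non-punctured) spaces $E_j$. \textbf{Proposition.} The following are equivalent. (a) $\xi_1\perp\xi_2\mid\xi_3$. (b) For $\Lambda_3^o$-a.e. $y_3$ one has $\Lambda_{12\mid 3^o}(\cdot\mid y_3)=\Lambda_{1\mid 3^o}(\cdot\mid y_3)\otimes\Lambda_{2\mid 3^o}(\cdot\mid y_3)$, and moreover $\Lambda(y_1\ne o_1,\,y_2\ne o_2,\,y_3=o_3)=0$. (c) There exist measurable functions $h_j:E_3\times[0,1]\to E_j$ with $h_j(o_3,\cdot)\equiv o_j$, $j=1,2$, such that \[ \xi\ \overset{d}{=}\ \sum_{i\le\kappa}\delta_{\left(h_1(\eta_{i3},\theta_{i1})+\eta_{i1},\ h_2(\eta_{i3},\theta_{i2})+\eta_{i2},\ \eta_{i3}\right)} . \] Here $\sum_{i\le\kappa}\delta_{(\eta_{i1},\eta_{i2},\eta_{i3})}$, with a random number $\kappa\in\{0,1,\dots,\infty\}$ of random points, is an enumeration of a Poisson point process on $E_{123}^o$ with mean measure $\Lambda^\perp_{12;3}$ (so that $\kappa=\infty$ a.s. if $\Lambda^\perp_{12;3}$ has infinite total mass); $(\theta_{i1})_i$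 and $(\theta_{i2})_i$ are i.i.d. sequences, uniform on $[0,1]$, independent of each other and, jointly, of the enumeration $(\kappa,(\eta_i)_i)$; and $+$ is defined by $y_j+o_j=o_j+y_j=y_j$. The equivalence of (a) and (b) holds for every version of the kernel $\Lambda_{12\mid3^o}$, and the equivalence of (a) and (c) for every given enumeration $(\kappa,(\eta_i)_i)$ and sequences $(\theta_{i1})_i$, $(\theta_{i2})_i$ as described. -/

import Mathlib

open MeasureTheory ProbabilityTheory
open scoped ENNReal unitInterval

noncomputable section

namespace PoissonCI

universe u v w

/-! ### Point measures and Poisson processes -/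

section Poisson

variable {E : Type u} [MeasurableSpace E] {Ω : Type v} [MeasurableSpace Ω]

/-- A point measure: an s-finite measure with values in `{0, 1, 2, …, ∞}`. -/
def IsPointMeasure (ν : Measure E) : Prop :=
  SFinite ν ∧ ∀ A : Set E, MeasurableSet A → ∃ n : ℕ∞, ν A = (n : ℝ≥0∞)

/-- The Poisson distribution with mean `m ∈ [0, ∞]`, as a measure on `[0, ∞]`; mean `0` gives the
unit mass at `0` and mean `∞` the unit mass at `∞`. -/
def poissonLaw (m : ℝ≥0∞) : Measure ℝ≥0∞ :=
  if m = ∞ then Measure.dirac ∞ else (poissonMeasure m.toNNReal).map (fun n : ℕ => (n : ℝ≥0∞))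

/-- `N` is a Poisson point process with mean measure `Λ`, defined on the probability space
`(Ω, μ)`. The σ-algebra on `Measure E` is generated by the evaluations at measurable sets. -/
structure IsPoissonProcess (N : Ω → Measure E) (Λ : Measure E) (μ : Measure Ω) : Prop where
  measurable : Measurable N
  isPointMeasure : ∀ ω, IsPointMeasure (N ω)
  law_apply : ∀ A : Set E, MeasurableSet A → μ.map (fun ω => N ω A) = poissonLaw (Λ A)
  indep : ∀ (m : ℕ) (A : Fin m → Set E), (∀ i, MeasurableSet (A i)) →
    Pairwise (fun i j => Disjoint (A i) (A j)) → iIndepFun (fun i ω => N ω (A i)) μ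

/-- The point measure `∑_{i < κ} δ_{y i}`, for `κ ∈ {0, 1, …, ∞}`. -/
def pointSum (κ : ℕ∞) (y : ℕ → E) : Measure E :=
  Measure.sum fun i : ℕ => if (i : ℕ∞) < κ then Measure.dirac (y i) else 0

/-- The random number `κ` and the random points `η i` enumerate a Poisson point process
`∑_{i < κ} δ_{η i}` with mean measure `Λ`. -/
structure IsPoissonEnumeration (κ : Ω → ℕ∞) (η : ℕ → Ω → E) (Λ : Measure E) (μ : Measure Ω) :
    Prop where
  measurable_count : Measurable κ
  measurable_point : ∀ i, Measurable (η i)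
  isPoisson : IsPoissonProcess (fun ω => pointSum (κ ω) (fun i => η i ω)) Λ μ

/-- `θ` is a sequence of independent random variables, uniformly distributed on `[0, 1]`. -/
structure IsUniformSeq (θ : ℕ → Ω → I) (μ : Measure Ω) : Prop where
  measurable : ∀ i, Measurable (θ i)
  law : ∀ i, μ.map (θ i) = volume
  indep : iIndepFun θ μ

end Poisson

/-- Conditional independence of the random elements `X` and `Y` given the σ-algebra generated by
`Z`. (Mathlib's `CondIndepFun` is available over standard Borel probability spaces only.) -/
def CondIndep {Ω : Type u} [MeasurableSpace Ω] {S₁ S₂ S₃ : Type*} [MeasurableSpace S₁]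
    [MeasurableSpace S₂] [MeasurableSpace S₃] (X : Ω → S₁) (Y : Ω → S₂) (Z : Ω → S₃)
    (μ : Measure Ω) : Prop :=
  ∀ (A : Set S₁) (B : Set S₂), MeasurableSet A → MeasurableSet B →
    μ⟦X ⁻¹' A ∩ Y ⁻¹' B | MeasurableSpace.comap Z inferInstance⟧ =ᵐ[μ]
      μ⟦X ⁻¹' A | MeasurableSpace.comap Z inferInstance⟧ *
        μ⟦Y ⁻¹' B | MeasurableSpace.comap Z inferInstance⟧

/-! ### Punctured spaces -/

/-- The space `E` with the point `o` removed, with the trace σ-algebra. -/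
abbrev Punctured {E : Type u} (o : E) : Type u := {y : E // y ≠ o}

/-- The sets `L 0 ⊆ L 1 ⊆ ⋯` localize the punctured space `E \ {o}`. -/
structure IsLocalizing {E : Type u} [MeasurableSpace E] (o : E) (L : ℕ → Set E) : Prop where
  measurableSet : ∀ h, MeasurableSet (L h)
  mono : Monotone L
  iUnion_eq : ⋃ h, L h = {y | y ≠ o}

section Product

variable {E₁ : Type u} {E₂ : Type v} {E₃ : Type w} {o₁ : E₁} {o₂ : E₂} {o₃ : E₃}

/-- The localizing sequence
`(L₁ h × E₂ × E₃) ∪ (E₁ × L₂ h × E₃) ∪ (E₁ × E₂ × L₃ h)` of the punctured product space. -/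
def localizingProd (L₁ : ℕ → Set E₁) (L₂ : ℕ → Set E₂) (L₃ : ℕ → Set E₃) (h : ℕ) :
    Set (Punctured (o₁, o₂, o₃)) :=
  {y | y.1.1 ∈ L₁ h ∨ y.1.2.1 ∈ L₂ h ∨ y.1.2.2 ∈ L₃ h}

/-- The inclusion of `E₁ × E₂ × (E₃ \ {o₃})` into the punctured product space. -/
def inclThird (y : E₁ × E₂ × Punctured o₃) : Punctured (o₁, o₂, o₃) :=
  ⟨(y.1, y.2.1, y.2.2.1), fun h => y.2.2.2 (congrArg (fun z => z.2.2) h)⟩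

variable [MeasurableSpace E₁] [MeasurableSpace E₂] [MeasurableSpace E₃]

/-- The projection to `E₁` (not punctured) of a measure on the punctured product space. -/
def proj₁ (ν : Measure (Punctured (o₁, o₂, o₃))) : Measure E₁ := ν.map fun y => y.1.1

/-- The projection to `E₂` (not punctured) of a measure on the punctured product space. -/
def proj₂ (ν : Measure (Punctured (o₁, o₂, o₃))) : Measure E₂ := ν.map fun y => y.1.2.1

/-- The projection to `E₃` (not punctured) of a measure on the punctured product space. -/
def proj₃ (ν : Measure (Punctured (o₁, o₂, o₃))) : Measure E₃ := ν.map fun y => y.1.2.2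

/-- The third marginal measure, restricted to `E₃ \ {o₃}`. -/
def marginal₃ (Λ : Measure (Punctured (o₁, o₂, o₃))) : Measure (Punctured o₃) :=
  (proj₃ Λ).comap Subtype.val

/-- The restriction of a measure on the punctured product space to `E₁ × E₂ × (E₃ \ {o₃})`. -/
def restrictThird (Λ : Measure (Punctured (o₁, o₂, o₃))) : Measure (E₁ × E₂ × Punctured o₃) :=
  Λ.comap inclThird

/-- The kernel `K` is a version of the conditional kernel of the first two coordinates given the
third one, on the part of the space where the third coordinate is not `o₃`. -/
def IsDisintegration (Λ : Measure (Punctured (o₁, o₂, o₃)))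
    (K : Kernel (Punctured o₃) (E₁ × E₂)) : Prop :=
  IsMarkovKernel K ∧ ∀ A : Set (E₁ × E₂ × Punctured o₃), MeasurableSet A →
    restrictThird Λ A = ∫⁻ y₃, K y₃ {p | (p.1, p.2, y₃) ∈ A} ∂(marginal₃ Λ)

/-- The point `(o₁, o₂, y₃)` of the punctured product space. -/
def axis₃ (y₃ : Punctured o₃) : Punctured (o₁, o₂, o₃) := inclThird (o₁, o₂, y₃)

/-- The extremally independent mean measure: `Λ` restricted to the points `(y₁, o₂, o₃)`, plus `Λ`
restricted to the points `(o₁, y₂, o₃)`, plus the third punctured marginal of `Λ` carried over to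
the points `(o₁, o₂, y₃)`. -/
def extremalIndep (Λ : Measure (Punctured (o₁, o₂, o₃))) : Measure (Punctured (o₁, o₂, o₃)) :=
  Λ.restrict {y | y.1.2.1 = o₂ ∧ y.1.2.2 = o₃} + Λ.restrict {y | y.1.1 = o₁ ∧ y.1.2.2 = o₃} +
    (marginal₃ Λ).map axis₃

open Classical in
/-- The partial addition for which `o` is neutral: `x + o = o + x = x`. The value at two points that
both differ from `o` is immaterial. -/
def padd {E : Type u} (o x y : E) : E := if x = o then y else x

/-- The point `(h₁(y₃, s) + y₁, h₂(y₃, t) + y₂, y₃)` for a point `y` of the punctured product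
space; it is again in the punctured product space because `h₁` and `h₂` vanish at `o₃`. -/
def representPoint (h₁ : E₃ × I → E₁) (h₂ : E₃ × I → E₂) (hh₁ : ∀ s, h₁ (o₃, s) = o₁)
    (hh₂ : ∀ t, h₂ (o₃, t) = o₂) (y : Punctured (o₁, o₂, o₃)) (s t : I) :
    Punctured (o₁, o₂, o₃) :=
  ⟨(padd o₁ (h₁ (y.1.2.2, s)) y.1.1, padd o₂ (h₂ (y.1.2.2, t)) y.1.2.1, y.1.2.2), by
    intro h
    have h3 : y.1.2.2 = o₃ := congrArg (fun z => z.2.2) h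
    have h1 := congrArg (fun z => z.1) h
    have h2 := congrArg (fun z => z.2.1) h
    simp only [h3, hh₁, hh₂, padd, if_true] at h1 h2
    exact y.2 (Prod.ext h1 (Prod.ext h2 h3))⟩

end Product

end PoissonCI

end

/-! The proof compares Laplace functionals, E exp(-ξf) = exp(-∫ (1 - exp(-f)) dΛ), for f with values
in [0, ∞]. The value ∞ is essential: f = ∞·1_A gives the void probability of A. Since exp(-·) is
injective on [0, ∞], equal functionals of this form have equal exponents.

The central computation is `IsPoissonProcess.condLaplace_proj₃`. Split Λ at {y₃ = o₃} and
disintegrate the rest by K. On {y₃ = o₃} a function of y₃ is a constant, and this constant decouples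
because the mass of the set is 0 or ∞ (`expNeg_lintegral_add_const`). Hence, given ξ₃, the Laplace
functional of a function F of (y₁, y₂) is a deterministic factor, `axisFactor`, times exp(-∫ g dξ₃)
with g = -log ∫ exp(-F) dK off o₃ and g(o₃) = 0. In other words, the points off o₃ carry independent
marks with law K, and those over o₃ contribute independently of ξ₃.

(b) ⇒ (a): for F = f₁(y₁) + f₂(y₂) the kernel integral factorizes because K is a product. The
deterministic factor does so because Λ lives on two axes over o₃, each of mass 0 or ∞
(`axisFactor_add`). Such a factorization of Laplace functionals implies conditional independence
(`condIndep_of_laplace`).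

(a) ⇒ (b): take F = ∞·1_D for D = {y₁ ∈ B₁}, {y₂ ∈ B₂} and their union. Conditional independence
relates the three conditional void probabilities; integrating over the event that ξ₃ has no point in
C gives an identity of exponents (`IsPoissonProcess.void_eq_of_condIndep`). For bounded B₁, B₂ the
relevant terms are finite. Varying C identifies K on B₁ᶜ × B₂ᶜ, and what remains says that Λ is
additive over the two sets on {y₃ = o₃}, so their intersection is null.

(c): marking the process with mean `extremalIndep Λ` gives the Laplace functional of a Poisson
process whose kernel is the product of the laws of h₁(y₃, ·) and h₂(y₃, ·), and whose part over o₃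
is Λ on the two axes. Comparing exponents links this with (b) in both directions. -/

noncomputable section

namespace PoissonCI

/-! ### The exponential `x ↦ exp (-x)` on `[0, ∞]` -/

/-- The function `x ↦ exp (-x)` on `[0, ∞]`, with `exp (-∞) = 0`. -/
def expNeg (x : ℝ≥0∞) : ℝ≥0∞ := EReal.exp (-(x : EReal))

/-- The function `x ↦ -log x` on `[0, 1]`, extended by `0`. -/
def negLog (x : ℝ≥0∞) : ℝ≥0∞ := (-(ENNReal.log x)).toENNReal

@[simp] lemma expNeg_zero : expNeg 0 = 1 := by simp [expNeg]

@[simp] lemma expNeg_top : expNeg ∞ = 0 := by simp [expNeg]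

lemma expNeg_add (x y : ℝ≥0∞) : expNeg (x + y) = expNeg x * expNeg y := by
  simp only [expNeg, EReal.coe_ennreal_add]
  rw [EReal.neg_add (by simp) (by simp), sub_eq_add_neg, EReal.exp_add]

lemma expNeg_strictAnti : StrictAnti expNeg := fun x y h => by
  simpa [expNeg] using h

lemma expNeg_antitone : Antitone expNeg := expNeg_strictAnti.antitone

lemma expNeg_injective : Function.Injective expNeg := expNeg_strictAnti.injective

lemma expNeg_le_one (x : ℝ≥0∞) : expNeg x ≤ 1 := by
  simpa using expNeg_antitone (zero_le (a := x))

lemma expNeg_ne_top (x : ℝ≥0∞) : expNeg x ≠ ∞ := ne_top_of_le_ne_top ENNReal.one_ne_top (expNeg_le_one x)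

lemma expNeg_eq_one {x : ℝ≥0∞} : expNeg x = 1 ↔ x = 0 := by
  rw [← expNeg_zero, expNeg_injective.eq_iff]

lemma continuous_expNeg : Continuous expNeg :=
  ENNReal.continuous_exp.comp (continuous_neg.comp continuous_coe_ennreal_ereal)

@[fun_prop] lemma measurable_expNeg : Measurable expNeg := continuous_expNeg.measurable

@[fun_prop] lemma measurable_negLog : Measurable negLog := by
  unfold negLog
  exact (ENNReal.measurable_log.neg).ereal_toENNReal

lemma expNeg_negLog {x : ℝ≥0∞} (hx : x ≤ 1) : expNeg (negLog x) = x := by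
  have h : 0 ≤ -(ENNReal.log x) := by
    rw [EReal.le_neg]; simpa using hx
  rw [expNeg, negLog, EReal.coe_toENNReal h, neg_neg, ENNReal.exp_log]

lemma negLog_expNeg (x : ℝ≥0∞) : negLog (expNeg x) = x :=
  expNeg_injective (expNeg_negLog (expNeg_le_one x))

lemma expNeg_sum {ι : Type*} (s : Finset ι) (f : ι → ℝ≥0∞) :
    expNeg (∑ i ∈ s, f i) = ∏ i ∈ s, expNeg (f i) := by
  classical
  induction s using Finset.induction_on with
  | empty => simp
  | insert a s ha ih => rw [Finset.sum_insert ha, Finset.prod_insert ha, expNeg_add, ih]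

lemma expNeg_nat_mul (n : ℕ) (x : ℝ≥0∞) : expNeg (n * x) = expNeg x ^ n := by
  induction n with
  | zero => simp
  | succ n ih => push_cast; rw [add_mul, one_mul, expNeg_add, ih, pow_succ]

lemma expNeg_ofReal {x : ℝ} (hx : 0 ≤ x) :
    expNeg (ENNReal.ofReal x) = ENNReal.ofReal (Real.exp (-x)) := by
  rw [expNeg, EReal.coe_ennreal_ofReal, max_eq_left hx, ← EReal.coe_neg, EReal.exp_coe]

lemma expNeg_top_mul (x : ℝ≥0∞) : expNeg (∞ * x) = if x = 0 then 1 else 0 := by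
  split_ifs with h
  · simp [h]
  · simp [ENNReal.top_mul h]

/-! ### Finite measures are determined by exponential moments -/

section Uniqueness

variable {S : Type*} [MeasurableSpace S]

/-- The unit interval-valued vector `(exp (-f s))_{f ∈ t}`. -/
def expNegVec (t : Finset (S → ℝ≥0∞)) (s : S) : t → I := fun f =>
  ⟨(expNeg (f.1 s)).toReal, ENNReal.toReal_nonneg,
    ENNReal.toReal_le_of_le_ofReal zero_le_one (by simpa using expNeg_le_one _)⟩

lemma measurable_expNegVec {t : Finset (S → ℝ≥0∞)} (ht : ∀ f ∈ t, Measurable f) :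
    Measurable (expNegVec t) := by
  refine measurable_pi_lambda _ fun f => Measurable.subtype_mk ?_
  have := ht f.1 f.2
  fun_prop

/-- The coordinate functions on a cube. -/
def cubeCoord {ι : Type*} [Finite ι] (i : ι) : BoundedContinuousFunction (ι → I) ℝ :=
  BoundedContinuousFunction.mkOfCompact ⟨fun x => (x i : ℝ), by fun_prop⟩

/-- The algebra of polynomial functions on a cube. -/
def cubePoly (ι : Type*) [Finite ι] : StarSubalgebra ℝ (BoundedContinuousFunction (ι → I) ℝ) :=
  { Algebra.adjoin ℝ (Set.range (cubeCoord (ι := ι))) with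
    star_mem' := fun {a} ha => by
      have : star a = a := by ext x; simp
      rw [this]; exact ha }

/-- Polynomials on the cube separate points and therefore determine a finite measure. A monomial in
the coordinates exp(-f) is again exp(-f') with f' in `T`, since `T` is closed under addition. -/
lemma map_expNegVec_eq {P Q : Measure S} [IsFiniteMeasure P] [IsFiniteMeasure Q]
    (T : AddSubmonoid (S → ℝ≥0∞)) (hT : ∀ f ∈ T, Measurable f)
    (h : ∀ f ∈ T, ∫⁻ s, expNeg (f s) ∂P = ∫⁻ s, expNeg (f s) ∂Q)
    (t : Finset (S → ℝ≥0∞)) (ht : ∀ f ∈ t, f ∈ T) :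
    P.map (expNegVec t) = Q.map (expNegVec t) := by
  have hm := measurable_expNegVec fun f hf => hT f (ht f hf)
  refine ext_of_forall_mem_subalgebra_integral_eq_of_polish (𝕜 := ℝ) (A := cubePoly t) ?_ ?_
  · intro x y hxy
    obtain ⟨i, hi⟩ := Function.ne_iff.1 hxy
    refine ⟨_, ⟨_, ⟨cubeCoord i, Algebra.subset_adjoin ⟨i, rfl⟩, rfl⟩, rfl⟩, ?_⟩
    simpa [cubeCoord, Subtype.ext_iff] using hi
  · intro g hg
    replace hg : g ∈ Submodule.span ℝ
        (Submonoid.closure (Set.range (cubeCoord (ι := t))) : Set _) := by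
      rw [← Algebra.adjoin_eq_span]; exact hg
    rw [integral_map hm.aemeasurable (by fun_prop), integral_map hm.aemeasurable (by fun_prop)]
    have key : ∀ g ∈ Submonoid.closure (Set.range (cubeCoord (ι := t))),
        ∃ f ∈ T, ∀ s, g (expNegVec t s) = (expNeg (f s)).toReal := by
      intro g hg
      induction hg using Submonoid.closure_induction with
      | mem x hx =>
        obtain ⟨i, rfl⟩ := hx
        exact ⟨i.1, ht _ i.2, fun s => rfl⟩
      | one => exact ⟨0, T.zero_mem, fun s => by simp⟩
      | mul x y _ _ hx hy =>
        obtain ⟨f, hf, hfx⟩ := hx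
        obtain ⟨f', hf', hfy⟩ := hy
        exact ⟨f + f', T.add_mem hf hf', fun s => by
          simp [hfx, hfy, expNeg_add]⟩
    have hint : ∀ (R : Measure S) [IsFiniteMeasure R] (g : BoundedContinuousFunction (t → I) ℝ),
        Integrable (fun s => g (expNegVec t s)) R := fun R _ g =>
      Integrable.of_bound (g.continuous.measurable.comp hm).aestronglyMeasurable ‖g‖
        (ae_of_all _ fun s => g.norm_coe_le_norm _)
    induction hg using Submodule.span_induction with
    | mem x hx =>
      obtain ⟨f, hf, hfx⟩ := key x hx
      have hfm := hT f hf
      simp_rw [hfx]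
      rw [integral_toReal (by fun_prop) (ae_of_all _ fun s => (expNeg_ne_top _).lt_top),
        integral_toReal (by fun_prop) (ae_of_all _ fun s => (expNeg_ne_top _).lt_top), h f hf]
    | zero => simp
    | add x y _ _ hx hy =>
      simp only [BoundedContinuousFunction.coe_add, Pi.add_apply]
      rw [integral_add (hint P x) (hint P y), integral_add (hint Q x) (hint Q y), hx, hy]
    | smul a x _ hx =>
      simp only [BoundedContinuousFunction.coe_smul, integral_smul, hx]

/-- A finite measure is determined by the integrals of `exp (-f)`, where `f` runs through an
additive class of functions which generates the σ-algebra. -/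
theorem ext_of_lintegral_expNeg {P Q : Measure S} [IsFiniteMeasure P] [IsFiniteMeasure Q]
    (T : AddSubmonoid (S → ℝ≥0∞)) (hT : ∀ f ∈ T, Measurable f)
    (hgen : (inferInstance : MeasurableSpace S) ≤ ⨆ f ∈ T, MeasurableSpace.comap f inferInstance)
    (h : ∀ f ∈ T, ∫⁻ s, expNeg (f s) ∂P = ∫⁻ s, expNeg (f s) ∂Q) : P = Q := by
  have hgen' : (inferInstance : MeasurableSpace S) =
      ⨆ f ∈ (T : Set (S → ℝ≥0∞)), MeasurableSpace.comap f inferInstance :=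
    le_antisymm hgen (iSup₂_le fun f hf => (hT f hf).comap_le)
  rw [← generateFrom_piiUnionInter_measurableSet] at hgen'
  refine ext_of_generate_finite _ hgen'
    (isPiSystem_piiUnionInter _ (fun f => @MeasurableSpace.isPiSystem_measurableSet _
      -- The total masses agree by testing with f = 0.
      (MeasurableSpace.comap f inferInstance)) _) ?_ (by simpa using h 0 T.zero_mem)
  rintro _ ⟨t, htT, B, hB, rfl⟩
  choose! C hC hCB using hB
  have hm := measurable_expNegVec fun f hf => hT f (htT hf)
  -- `negLog` recovers each f from exp(-f), so a finite intersection of events in the functions f is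
  -- an event in the cube-valued vector.
  have hset : ⋂ f ∈ t, B f = expNegVec t ⁻¹'
      (⋂ f : t, {x | negLog (ENNReal.ofReal (x f)) ∈ C f.1}) := by
    ext s
    simp only [Set.mem_iInter, Set.mem_preimage, Set.mem_ofPred_eq, Subtype.forall]
    refine forall₂_congr fun f hf => ?_
    rw [← hCB f hf]
    simp [expNegVec, ENNReal.ofReal_toReal (expNeg_ne_top _), negLog_expNeg]
  have hmeas : MeasurableSet (⋂ f : t, {x : t → I | negLog (ENNReal.ofReal (x f)) ∈ C f.1}) := by
    refine MeasurableSet.iInter fun f => ?_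
    have : Measurable fun x : t → I => negLog (ENNReal.ofReal (x f)) := by fun_prop
    exact this (hC f.1 f.2)
  rw [hset, ← Measure.map_apply hm hmeas, ← Measure.map_apply hm hmeas,
    map_expNegVec_eq T hT h t htT]

end Uniqueness

/-! ### The Laplace functional of a Poisson process -/

section Laplace

variable {E : Type*} [MeasurableSpace E] {Ω : Type*} [MeasurableSpace Ω]

/-- For finite m this is the Poisson generating function at q = exp(-c), with q = 0 if c = ∞. For m
= ∞ both sides are the indicator of c = 0. -/
lemma lintegral_poissonLaw (m c : ℝ≥0∞) :
    ∫⁻ x, expNeg (c * x) ∂(poissonLaw m) = expNeg (m * (1 - expNeg c)) := by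
  have hmeas : Measurable fun x : ℝ≥0∞ => expNeg (c * x) := by fun_prop
  unfold poissonLaw
  split_ifs with hm
  · rw [lintegral_dirac' _ hmeas, hm, mul_comm c, expNeg_top_mul, expNeg_top_mul]
    congr 1
    rw [tsub_eq_zero_iff_le, ← expNeg_zero, expNeg_strictAnti.le_iff_ge, nonpos_iff_eq_zero]
  · lift m to NNReal using hm
    obtain ⟨q, hq0, hq1, hq⟩ : ∃ q : ℝ, 0 ≤ q ∧ q ≤ 1 ∧ expNeg c = ENNReal.ofReal q :=
      ⟨(expNeg c).toReal, ENNReal.toReal_nonneg,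
        ENNReal.toReal_le_of_le_ofReal zero_le_one (by simpa using expNeg_le_one c),
        (ENNReal.ofReal_toReal (expNeg_ne_top c)).symm⟩
    have hs : HasSum (fun n : ℕ => Real.exp (-m) * m ^ n / (n.factorial : ℝ) * q ^ n)
        (Real.exp (-(m * (1 - q)))) := by
      have := (NormedSpace.expSeries_div_hasSum_exp ((m : ℝ) * q)).mul_left (Real.exp (-m))
      rw [← Real.exp_eq_exp_ℝ, ← Real.exp_add] at this
      rw [show -((m : ℝ) * (1 - q)) = -m + m * q by ring]
      refine this.congr_fun fun n => ?_
      rw [mul_pow]; ring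
    rw [lintegral_map hmeas .of_discrete, ENNReal.toNNReal_coe, poissonMeasure,
      lintegral_sum_measure]
    simp only [lintegral_smul_measure, lintegral_dirac, smul_eq_mul]
    have hrhs : (m : ℝ≥0∞) * (1 - expNeg c) = ENNReal.ofReal (m * (1 - q)) := by
      rw [ENNReal.ofReal_mul m.coe_nonneg, ENNReal.ofReal_coe_nnreal, ENNReal.ofReal_sub _ hq0, hq,
        ENNReal.ofReal_one]
    rw [hrhs, expNeg_ofReal (mul_nonneg m.coe_nonneg (by linarith)), ← hs.tsum_eq,
      ENNReal.ofReal_tsum_of_nonneg (fun n => by positivity) hs.summable]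
    congr 1
    ext n
    rw [mul_comm c, expNeg_nat_mul, hq, ← ENNReal.ofReal_pow hq0, ← ENNReal.ofReal_mul (by positivity)]

variable {μ : Measure Ω} {ξ : Ω → Measure E} {Λ : Measure E}

lemma measurable_lintegral_of_measurable (hξ : Measurable ξ) {f : E → ℝ≥0∞}
    (hf : Measurable f) : Measurable fun ω => ∫⁻ y, f y ∂(ξ ω) :=
  (Measure.measurable_lintegral hf).comp hξ

lemma measurable_expNeg_lintegral {f : E → ℝ≥0∞} (hf : Measurable f) :
    Measurable fun ν : Measure E => expNeg (∫⁻ y, f y ∂ν) :=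
  measurable_expNeg.comp (Measure.measurable_lintegral hf)

/-- The fibres of f are disjoint, so exp(-ξf) is a product of independent functions of Poisson
counts. -/
lemma IsPoissonProcess.laplace_simpleFunc (hξ : IsPoissonProcess ξ Λ μ)
    (f : SimpleFunc E ℝ≥0∞) :
    ∫⁻ ω, expNeg (∫⁻ y, f y ∂(ξ ω)) ∂μ = expNeg (∫⁻ y, (1 - expNeg (f y)) ∂Λ) := by
  classical
  have hmeas : ∀ A, MeasurableSet A → Measurable fun ω => ξ ω A := fun A hA =>
    (Measure.measurable_coe hA).comp hξ.measurable
  have hrhs : ∫⁻ y, (1 - expNeg (f y)) ∂Λ = ∑ c : f.range, Λ (f ⁻¹' {c.1}) * (1 - expNeg c.1) := by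
    have h1 := SimpleFunc.lintegral_eq_lintegral (f.map fun c => 1 - expNeg c) Λ
    rw [SimpleFunc.map_lintegral] at h1
    rw [← Finset.sum_coe_sort] at h1
    simpa [mul_comm] using h1
  have hind : iIndepFun (fun (c : f.range) ω => ξ ω (f ⁻¹' {c.1})) μ := by
    have := hξ.indep (Fintype.card f.range)
      (fun i => f ⁻¹' {((Fintype.equivFin f.range).symm i).1})
      (fun i => f.measurableSet_fiber _) (fun i j hij => by
        refine Disjoint.preimage _ (Set.disjoint_singleton.2 fun h => hij ?_)
        exact (Fintype.equivFin f.range).symm.injective (Subtype.ext h))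
    have h2 := this.precomp (Fintype.equivFin f.range).injective
    simpa using h2
  have hind' : iIndepFun (fun (c : f.range) ω => expNeg (c.1 * ξ ω (f ⁻¹' {c.1}))) μ :=
    hind.comp (fun c x => expNeg (c.1 * x)) fun c => by fun_prop
  calc ∫⁻ ω, expNeg (∫⁻ y, f y ∂(ξ ω)) ∂μ
      = ∫⁻ ω, ∏ c : f.range, expNeg (c.1 * ξ ω (f ⁻¹' {c.1})) ∂μ := by
        refine lintegral_congr fun ω => ?_
        rw [SimpleFunc.lintegral_eq_lintegral, SimpleFunc.lintegral, ← Finset.sum_coe_sort,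
          expNeg_sum]
    _ = ∏ c : f.range, ∫⁻ ω, expNeg (c.1 * ξ ω (f ⁻¹' {c.1})) ∂μ := by
        refine lintegral_prod_eq_prod_lintegral_of_indepFun _ _ hind' fun c => ?_
        have := hmeas _ (f.measurableSet_fiber c.1)
        fun_prop
    _ = ∏ c : f.range, expNeg (Λ (f ⁻¹' {c.1}) * (1 - expNeg c.1)) := by
        refine Finset.prod_congr rfl fun c _ => ?_
        rw [← lintegral_poissonLaw, ← hξ.law_apply _ (f.measurableSet_fiber c.1),
          lintegral_map (by fun_prop) (hmeas _ (f.measurableSet_fiber c.1))]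
    _ = _ := by rw [hrhs, expNeg_sum]

/-- The Laplace functional of a Poisson process. -/
theorem IsPoissonProcess.laplace [IsFiniteMeasure μ] (hξ : IsPoissonProcess ξ Λ μ)
    {f : E → ℝ≥0∞} (hf : Measurable f) :
    ∫⁻ ω, expNeg (∫⁻ y, f y ∂(ξ ω)) ∂μ = expNeg (∫⁻ y, (1 - expNeg (f y)) ∂Λ) := by
  have hlim : ∀ y, Filter.Tendsto (fun n => SimpleFunc.eapprox f n y) Filter.atTop
      (nhds (f y)) := fun y => SimpleFunc.tendsto_eapprox hf y
  have hmono : ∀ y, Monotone fun n => SimpleFunc.eapprox f n y := fun y m n hmn =>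
    SimpleFunc.monotone_eapprox f hmn y
  -- The inner integrals increase to ∫ f dξ, possibly ∞. Since exp(-·) is continuous on [0, ∞] and
  -- bounded by 1, the expectations converge.
  have hleft : Filter.Tendsto (fun n => ∫⁻ ω, expNeg (∫⁻ y, SimpleFunc.eapprox f n y ∂(ξ ω)) ∂μ)
      Filter.atTop (nhds (∫⁻ ω, expNeg (∫⁻ y, f y ∂(ξ ω)) ∂μ)) := by
    refine tendsto_lintegral_of_dominated_convergence (fun _ => 1)
      (fun n => measurable_expNeg.comp (measurable_lintegral_of_measurable hξ.measurable
        (SimpleFunc.measurable _)))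
      (fun n => ae_of_all _ fun ω => expNeg_le_one _) (by simp) (ae_of_all _ fun ω => ?_)
    refine (continuous_expNeg.tendsto _).comp ?_
    exact lintegral_tendsto_of_tendsto_of_monotone (fun n => (SimpleFunc.measurable _).aemeasurable)
      (ae_of_all _ hmono) (ae_of_all _ hlim)
  have hright : Filter.Tendsto
      (fun n => expNeg (∫⁻ y, (1 - expNeg (SimpleFunc.eapprox f n y)) ∂Λ))
      Filter.atTop (nhds (expNeg (∫⁻ y, (1 - expNeg (f y)) ∂Λ))) := by
    refine (continuous_expNeg.tendsto _).comp ?_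
    refine lintegral_tendsto_of_tendsto_of_monotone (fun n => ?_)
      (ae_of_all _ fun y m n hmn => tsub_le_tsub_left (expNeg_antitone (hmono y hmn)) 1)
      (ae_of_all _ fun y => ?_)
    · have := SimpleFunc.measurable (SimpleFunc.eapprox f n)
      fun_prop
    · exact ENNReal.Tendsto.sub tendsto_const_nhds ((continuous_expNeg.tendsto _).comp (hlim y))
        (Or.inl ENNReal.one_ne_top)
  refine tendsto_nhds_unique hleft (hright.congr fun n => ?_)
  exact (hξ.laplace_simpleFunc _).symm

/-- The additive class of functionals `ν ↦ ∫ f dν` on the space of measures. -/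
def lintegralFunctionals (E : Type*) [MeasurableSpace E] : AddSubmonoid (Measure E → ℝ≥0∞) where
  carrier := {φ | ∃ f : E → ℝ≥0∞, Measurable f ∧ φ = fun ν => ∫⁻ y, f y ∂ν}
  zero_mem' := ⟨0, measurable_zero, by ext; simp⟩
  add_mem' := by
    rintro _ _ ⟨f, hf, rfl⟩ ⟨g, hg, rfl⟩
    exact ⟨f + g, hf.add hg, by ext ν; simp [lintegral_add_left hf]⟩

/-- A finite measure on the space of measures is determined by its Laplace functional. -/
theorem ext_of_laplace {P Q : Measure (Measure E)} [IsFiniteMeasure P] [IsFiniteMeasure Q]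
    (h : ∀ f : E → ℝ≥0∞, Measurable f →
      ∫⁻ ν, expNeg (∫⁻ y, f y ∂ν) ∂P = ∫⁻ ν, expNeg (∫⁻ y, f y ∂ν) ∂Q) : P = Q := by
  refine ext_of_lintegral_expNeg (lintegralFunctionals E) ?_ ?_ ?_
  · rintro _ ⟨f, hf, rfl⟩
    exact Measure.measurable_lintegral hf
  · refine iSup₂_le fun A hA => le_iSup₂_of_le (fun ν => ν A) ?_ le_rfl
    exact ⟨A.indicator 1, measurable_one.indicator hA, by ext ν; simp [lintegral_indicator_one hA]⟩
  · rintro _ ⟨f, hf, rfl⟩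
    exact h f hf

/-- The law of a random measure is determined by its Laplace functional. -/
theorem identDistrib_of_laplace {Ω' : Type*} [MeasurableSpace Ω'] {μ' : Measure Ω'}
    [IsFiniteMeasure μ] [IsFiniteMeasure μ'] {ξ' : Ω' → Measure E}
    (hξ : Measurable ξ) (hξ' : Measurable ξ')
    (h : ∀ f : E → ℝ≥0∞, Measurable f → ∫⁻ ω, expNeg (∫⁻ y, f y ∂(ξ ω)) ∂μ =
      ∫⁻ ω, expNeg (∫⁻ y, f y ∂(ξ' ω)) ∂μ') : IdentDistrib ξ ξ' μ μ' := by
  refine ⟨hξ.aemeasurable, hξ'.aemeasurable, ext_of_laplace fun f hf => ?_⟩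
  have := measurable_expNeg_lintegral hf
  rw [lintegral_map this hξ, lintegral_map this hξ']
  exact h f hf

/-- Two densities with the same Laplace transform along a random measure are indistinguishable
from functions of this random measure. -/
theorem map_withDensity_eq_of_laplace {U V : Ω → ℝ≥0∞} (hξ : Measurable ξ)
    (hU : ∫⁻ ω, U ω ∂μ ≠ ∞) (hUm : Measurable U) (hVm : Measurable V)
    (h : ∀ f : E → ℝ≥0∞, Measurable f → ∫⁻ ω, U ω * expNeg (∫⁻ y, f y ∂(ξ ω)) ∂μ =
      ∫⁻ ω, V ω * expNeg (∫⁻ y, f y ∂(ξ ω)) ∂μ) :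
    (μ.withDensity U).map ξ = (μ.withDensity V).map ξ := by
  -- Finiteness of the second density comes from f = 0.
  have hV : ∫⁻ ω, V ω ∂μ ≠ ∞ := by
    have := h 0 measurable_zero
    simp only [Pi.zero_apply, lintegral_zero, expNeg_zero, mul_one] at this
    rwa [← this]
  have := isFiniteMeasure_withDensity hU
  have := isFiniteMeasure_withDensity hV
  refine ext_of_laplace fun f hf => ?_
  have hm := measurable_expNeg_lintegral hf
  have hm' := hm.comp hξ
  rw [lintegral_map hm hξ, lintegral_map hm hξ]
  erw [lintegral_withDensity_eq_lintegral_mul _ hUm hm',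
    lintegral_withDensity_eq_lintegral_mul _ hVm hm']
  exact h f hf

end Laplace

/-! ### Conditional probabilities as Radon–Nikodym densities -/

section CondProb

variable {Ω S : Type*} [MeasurableSpace Ω] [MeasurableSpace S] {μ : Measure Ω} {Z : Ω → S}

/-- `w ∘ Z` is a version of the conditional probability of `A` given `Z`. -/
structure IsCondProb (μ : Measure Ω) (Z : Ω → S) (A : Set Ω) (w : S → ℝ≥0∞) : Prop where
  measurable : Measurable w
  map_restrict : (μ.restrict A).map Z = (μ.map Z).withDensity w

/-- Radon–Nikodym: the law of Z restricted to A is dominated by the full law of Z. No regularity of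
`Ω` is needed. -/
lemma exists_isCondProb [IsFiniteMeasure μ] (hZ : Measurable Z) (A : Set Ω) :
    ∃ w, IsCondProb μ Z A w := by
  refine ⟨((μ.restrict A).map Z).rnDeriv (μ.map Z), Measure.measurable_rnDeriv _ _, ?_⟩
  exact (Measure.withDensity_rnDeriv_eq _ _
    (Measure.absolutelyContinuous_of_le (Measure.map_mono Measure.restrict_le_self hZ))).symm

lemma IsCondProb.setLIntegral {A : Set Ω} {w : S → ℝ≥0∞} (h : IsCondProb μ Z A w)
    (hZ : Measurable Z) {u : S → ℝ≥0∞} (hu : Measurable u) :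
    ∫⁻ ω in A, u (Z ω) ∂μ = ∫⁻ ω, w (Z ω) * u (Z ω) ∂μ := by
  rw [← lintegral_map hu hZ, h.map_restrict,
    lintegral_withDensity_eq_lintegral_mul _ h.measurable hu,
    lintegral_map (h.measurable.mul hu) hZ]
  rfl

lemma IsCondProb.lintegral_eq {A : Set Ω} {w : S → ℝ≥0∞} (h : IsCondProb μ Z A w)
    (hZ : Measurable Z) : ∫⁻ ω, w (Z ω) ∂μ = μ A := by
  have := h.setLIntegral hZ (u := fun _ => 1) measurable_const
  simpa using this.symm

lemma isCondProb_of_forall [IsFiniteMeasure μ] {A : Set Ω} {w : S → ℝ≥0∞}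
    (hZ : Measurable Z) (hw : Measurable w)
    (h : ∀ C, MeasurableSet C → μ (A ∩ Z ⁻¹' C) = ∫⁻ ω in Z ⁻¹' C, w (Z ω) ∂μ) :
    IsCondProb μ Z A w := by
  refine ⟨hw, Measure.ext fun C hC => ?_⟩
  rw [Measure.map_apply hZ hC, Measure.restrict_apply (hZ hC), withDensity_apply _ hC,
    setLIntegral_map hC hw hZ, Set.inter_comm, h C hC]

lemma IsCondProb.condExp_ae_eq [IsFiniteMeasure μ] {A : Set Ω} {w : S → ℝ≥0∞}
    (h : IsCondProb μ Z A w) (hA : MeasurableSet A) (hZ : Measurable Z) :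
    μ⟦A | MeasurableSpace.comap Z inferInstance⟧ =ᵐ[μ] fun ω => (w (Z ω)).toReal := by
  have hfin : ∫⁻ ω, w (Z ω) ∂μ ≠ ∞ := by rw [h.lintegral_eq hZ]; exact measure_ne_top _ _
  have hwZ : Measurable fun ω => w (Z ω) := h.measurable.comp hZ
  have hlt : ∀ᵐ ω ∂μ, w (Z ω) < ∞ := ae_lt_top hwZ hfin
  have hint : Integrable (fun ω => (w (Z ω)).toReal) μ :=
    integrable_toReal_of_lintegral_ne_top hwZ.aemeasurable hfin
  symm
  refine ae_eq_condExp_of_forall_setIntegral_eq hZ.comap_le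
    ((integrable_const (1 : ℝ)).indicator hA) (fun _ _ _ => hint.integrableOn) ?_ ?_
  · rintro _ ⟨C, hC, rfl⟩ -
    rw [integral_toReal hwZ.aemeasurable.restrict (ae_restrict_of_ae hlt),
      setIntegral_indicator hA]
    have := h.setLIntegral hZ (u := C.indicator 1) (measurable_one.indicator hC)
    have h1 : ∀ ω, w (Z ω) * C.indicator 1 (Z ω) = (Z ⁻¹' C).indicator (fun ω => w (Z ω)) ω := by
      intro ω
      by_cases hω : Z ω ∈ C <;> simp [Set.indicator, hω]
    simp_rw [h1] at this
    rw [lintegral_indicator (hZ hC)] at this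
    rw [← this]
    have h2 : ∫⁻ ω in A, C.indicator (1 : S → ℝ≥0∞) (Z ω) ∂μ = μ (Z ⁻¹' C ∩ A) := by
      rw [show (fun ω => C.indicator (1 : S → ℝ≥0∞) (Z ω)) = (Z ⁻¹' C).indicator 1 from rfl,
        lintegral_indicator_one (hZ hC), Measure.restrict_apply (hZ hC)]
    rw [h2]
    simp [Measure.real]
  · have : Measurable[MeasurableSpace.comap Z inferInstance] fun ω => (w (Z ω)).toReal :=
      (h.measurable.ennreal_toReal).comp (comap_measurable Z)
    exact this.stronglyMeasurable.aestronglyMeasurable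

/-- Extends an identity tested on exponentials of Z to all measurable u ≥ 0, bounded or not. -/
lemma lintegral_mul_comp_of_map_withDensity_eq {U V : Ω → ℝ≥0∞} (hZ : Measurable Z)
    (hU : Measurable U) (hV : Measurable V)
    (h : (μ.withDensity U).map Z = (μ.withDensity V).map Z) {u : S → ℝ≥0∞} (hu : Measurable u) :
    ∫⁻ ω, U ω * u (Z ω) ∂μ = ∫⁻ ω, V ω * u (Z ω) ∂μ := by
  have h1 := lintegral_withDensity_eq_lintegral_mul μ hU (hu.comp hZ)
  have h2 := lintegral_withDensity_eq_lintegral_mul μ hV (hu.comp hZ)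
  simp only [Function.comp_def, Pi.mul_apply] at h1 h2
  rw [← h1, ← h2, ← lintegral_map hu hZ, ← lintegral_map hu hZ, h]

end CondProb

/-! ### Conditional independence of random measures -/

section CondIndep

variable {Ω E₁ E₂ E₃ : Type*} [MeasurableSpace Ω] [MeasurableSpace E₁] [MeasurableSpace E₂]
  [MeasurableSpace E₃] {μ : Measure Ω} [IsProbabilityMeasure μ]
  {X : Ω → Measure E₁} {Y : Ω → Measure E₂} {Z : Ω → Measure E₃}

/-- Random measures `X` and `Y` are conditionally independent given the random measure `Z` if the
Laplace functional of `X`, conditionally given `Y` and `Z`, is an exponential functional of `Z`. -/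
theorem condIndep_of_laplace (hX : Measurable X) (hY : Measurable Y) (hZ : Measurable Z)
    (h : ∀ f₁ : E₁ → ℝ≥0∞, Measurable f₁ → ∃ (c : ℝ≥0∞) (g : E₃ → ℝ≥0∞), c ≤ 1 ∧ Measurable g ∧
      ∀ (f₂ : E₂ → ℝ≥0∞) (f₃ : E₃ → ℝ≥0∞), Measurable f₂ → Measurable f₃ →
        ∫⁻ ω, expNeg (∫⁻ y, f₁ y ∂(X ω)) * expNeg (∫⁻ y, f₂ y ∂(Y ω)) *
          expNeg (∫⁻ y, f₃ y ∂(Z ω)) ∂μ =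
        ∫⁻ ω, c * expNeg (∫⁻ y, g y ∂(Z ω)) * expNeg (∫⁻ y, f₂ y ∂(Y ω)) *
          expNeg (∫⁻ y, f₃ y ∂(Z ω)) ∂μ) :
    CondIndep X Y Z μ := by
  have mX := fun {f : E₁ → ℝ≥0∞} (hf : Measurable f) =>
    (measurable_expNeg_lintegral hf).comp hX
  have mY := fun {f : E₂ → ℝ≥0∞} (hf : Measurable f) =>
    (measurable_expNeg_lintegral hf).comp hY
  have mZ := fun {f : E₃ → ℝ≥0∞} (hf : Measurable f) =>
    (measurable_expNeg_lintegral hf).comp hZ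
  simp only [Function.comp_def] at mX mY mZ
  have fin : ∀ {U : Ω → ℝ≥0∞}, (∀ ω, U ω ≤ 1) → ∀ {ν : Measure Ω} [IsFiniteMeasure ν],
      ∫⁻ ω, U ω ∂ν ≠ ∞ := fun hU ν _ => by
    refine ne_top_of_le_ne_top ?_ (lintegral_mono hU)
    simp
  -- the conditional Laplace functional of `X` given `(Y, Z)`, integrated over `Y ∈ B`
  have step : ∀ f₁ : E₁ → ℝ≥0∞, Measurable f₁ → ∃ v : Measure E₃ → ℝ≥0∞, Measurable v ∧
      ∀ (B : Set (Measure E₂)) (u : Measure E₃ → ℝ≥0∞), MeasurableSet B → Measurable u →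
      ∫⁻ ω in Y ⁻¹' B, expNeg (∫⁻ y, f₁ y ∂(X ω)) * u (Z ω) ∂μ =
        ∫⁻ ω in Y ⁻¹' B, v (Z ω) * u (Z ω) ∂μ := by
    intro f₁ hf₁
    obtain ⟨c, g, hc, hg, H⟩ := h f₁ hf₁
    have hv : Measurable fun ν : Measure E₃ => c * expNeg (∫⁻ y, g y ∂ν) :=
      (measurable_expNeg_lintegral hg).const_mul c
    have hvZ := hv.comp hZ
    simp only [Function.comp_def] at hvZ
    refine ⟨_, hv, fun B u hB hu => ?_⟩
    -- The exponentials are replaced by general functions one variable at a time: in Z here, in Y in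
    -- `e2`, in X at the end.
    have e1 : ∀ f₂ : E₂ → ℝ≥0∞, Measurable f₂ → ∀ u : Measure E₃ → ℝ≥0∞, Measurable u →
        ∫⁻ ω, expNeg (∫⁻ y, f₁ y ∂(X ω)) * expNeg (∫⁻ y, f₂ y ∂(Y ω)) * u (Z ω) ∂μ =
        ∫⁻ ω, c * expNeg (∫⁻ y, g y ∂(Z ω)) * expNeg (∫⁻ y, f₂ y ∂(Y ω)) * u (Z ω) ∂μ := by
      intro f₂ hf₂ u hu
      exact lintegral_mul_comp_of_map_withDensity_eq hZ ((mX hf₁).mul (mY hf₂)) (hvZ.mul (mY hf₂))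
        (map_withDensity_eq_of_laplace hZ (fin fun ω => mul_le_one' (expNeg_le_one _) (expNeg_le_one _))
          ((mX hf₁).mul (mY hf₂)) (hvZ.mul (mY hf₂)) fun f₃ hf₃ => H f₂ f₃ hf₂ hf₃) hu
    -- The bound u ≤ 1 keeps the density integrable.
    have e2 : ∀ u : Measure E₃ → ℝ≥0∞, Measurable u → (∀ ν, u ν ≤ 1) →
        ∫⁻ ω in Y ⁻¹' B, expNeg (∫⁻ y, f₁ y ∂(X ω)) * u (Z ω) ∂μ =
        ∫⁻ ω in Y ⁻¹' B, c * expNeg (∫⁻ y, g y ∂(Z ω)) * u (Z ω) ∂μ := by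
      intro u hu hu1
      have := map_withDensity_eq_of_laplace (U := fun ω => expNeg (∫⁻ y, f₁ y ∂(X ω)) * u (Z ω))
        (V := fun ω => c * expNeg (∫⁻ y, g y ∂(Z ω)) * u (Z ω)) hY
        (fin fun ω => mul_le_one' (expNeg_le_one _) (hu1 _))
        ((mX hf₁).mul (hu.comp hZ)) (hvZ.mul (hu.comp hZ)) fun f₂ hf₂ => by
          simpa only [mul_right_comm] using e1 f₂ hf₂ u hu
      have := congrArg (fun P => P B) this
      simp only [Measure.map_apply hY hB] at this
      rwa [withDensity_apply _ (hY hB), withDensity_apply _ (hY hB)] at this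
    -- Testing again with exponentials of Z removes the bound on u. This is needed because u = `wB`
    -- · 1_C occurs below, and `wB` is only a density.
    have e3 : ((μ.restrict (Y ⁻¹' B)).withDensity fun ω => expNeg (∫⁻ y, f₁ y ∂(X ω))).map Z =
        ((μ.restrict (Y ⁻¹' B)).withDensity fun ω => c * expNeg (∫⁻ y, g y ∂(Z ω))).map Z :=
      map_withDensity_eq_of_laplace hZ (fin fun ω => expNeg_le_one _) (mX hf₁) hvZ
        fun f₃ hf₃ => e2 (fun ν => expNeg (∫⁻ y, f₃ y ∂ν))
          (measurable_expNeg_lintegral hf₃) fun ν => expNeg_le_one _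
    exact lintegral_mul_comp_of_map_withDensity_eq hZ (mX hf₁) hvZ e3 hu
  intro A B hA hB
  obtain ⟨wA, hwA⟩ := exists_isCondProb (μ := μ) hZ (X ⁻¹' A)
  obtain ⟨wB, hwB⟩ := exists_isCondProb (μ := μ) hZ (Y ⁻¹' B)
  have hwBZ := hwB.measurable.comp hZ
  have key : IsCondProb μ Z (X ⁻¹' A ∩ Y ⁻¹' B) fun ν => wA ν * wB ν := by
    refine isCondProb_of_forall hZ (hwA.measurable.mul hwB.measurable) fun C hC => ?_
    have hCm : Measurable (C.indicator (1 : Measure E₃ → ℝ≥0∞)) := measurable_one.indicator hC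
    -- Under the exponentials of X, v(Z) may be inserted on {Y ∈ B}; there 1_B(Y) is replaced by
    -- `wB`(Z), and v(Z) is converted back with B = univ.
    have e : (μ.withDensity fun ω => (Y ⁻¹' B).indicator 1 ω * C.indicator 1 (Z ω)).map X =
        (μ.withDensity fun ω => wB (Z ω) * C.indicator 1 (Z ω)).map X := by
      refine map_withDensity_eq_of_laplace hX (fin (U := fun ω => (Y ⁻¹' B).indicator 1 ω * C.indicator 1 (Z ω)) fun ω => mul_le_one'
        (Set.indicator_apply_le' (fun _ => le_rfl) fun _ => zero_le)
        (Set.indicator_apply_le' (fun _ => le_rfl) fun _ => zero_le))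
        ((measurable_one.indicator (hY hB)).mul (hCm.comp hZ)) (hwBZ.mul (hCm.comp hZ)) ?_
      intro f₁ hf₁
      obtain ⟨v, hv, H⟩ := step f₁ hf₁
      have h1 := H B _ hB hCm
      have h2 := H Set.univ (fun ν => wB ν * C.indicator 1 ν) MeasurableSet.univ
        (hwB.measurable.mul hCm)
      have h3 := hwB.setLIntegral hZ (hv.mul hCm)
      simp only [Set.preimage_univ, Measure.restrict_univ] at h2
      rw [← lintegral_indicator (hY hB)] at h1
      calc _ = _ := lintegral_congr fun ω => ?_
        _ = _ := h1
        _ = _ := h3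
        _ = _ := lintegral_congr fun ω => ?_
        _ = _ := h2.symm
        _ = _ := lintegral_congr fun ω => ?_
      · by_cases hω : ω ∈ Y ⁻¹' B
        · simp only [Set.indicator_of_mem hω, Pi.one_apply, one_mul, mul_comm]
        · simp only [Set.indicator_of_notMem hω, zero_mul]
      · exact mul_left_comm _ _ _
      · exact mul_comm _ _
    have e' := congrArg (fun P => P A) e
    simp only [Measure.map_apply hX hA] at e'
    rw [withDensity_apply _ (hX hA), withDensity_apply _ (hX hA)] at e'
    have e'' := hwA.setLIntegral hZ (hwB.measurable.mul hCm)
    simp only [Pi.mul_apply] at e''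
    rw [e''] at e'
    have l1 : ∀ ω, (Y ⁻¹' B).indicator (1 : Ω → ℝ≥0∞) ω * C.indicator 1 (Z ω) =
        (Y ⁻¹' B ∩ Z ⁻¹' C).indicator 1 ω := fun ω => by
      by_cases h1 : Y ω ∈ B <;> by_cases h2 : Z ω ∈ C <;> simp [Set.indicator, h1, h2]
    have l2 : ∀ ω, wA (Z ω) * (wB (Z ω) * C.indicator 1 (Z ω)) =
        (Z ⁻¹' C).indicator (fun ω => wA (Z ω) * wB (Z ω)) ω := fun ω => by
      by_cases h2 : Z ω ∈ C <;> simp [Set.indicator, h2]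
    simp_rw [l1, l2] at e'
    rw [lintegral_indicator_one ((hY hB).inter (hZ hC)), lintegral_indicator (hZ hC),
      Measure.restrict_apply ((hY hB).inter (hZ hC))] at e'
    rw [← e']
    congr 1
    ext ω; simp; tauto
  filter_upwards [key.condExp_ae_eq ((hX hA).inter (hY hB)) hZ, hwA.condExp_ae_eq (hX hA) hZ,
    hwB.condExp_ae_eq (hY hB) hZ] with ω h1 h2 h3
  rw [h1, Pi.mul_apply, h2, h3, ENNReal.toReal_mul]

end CondIndep

/-! ### Marked Poisson processes -/

section Marking

variable {Ω E : Type*} [MeasurableSpace Ω] [MeasurableSpace E] {μ : Measure Ω}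

lemma IsUniformSeq.lintegral_prod_eq {θ : ℕ → Ω → I} (hθ : IsUniformSeq θ μ) (s : Finset ℕ)
    {b : ℕ → I → ℝ≥0∞} (hb : ∀ i, Measurable (b i)) :
    ∫⁻ ω, ∏ i ∈ s, b i (θ i ω) ∂μ = ∏ i ∈ s, ∫⁻ x, b i x := by
  refine (lintegral_prod_eq_prod_lintegral_of_indepFun s _ (hθ.indep.comp b hb)
    fun i => (hb i).comp (hθ.measurable i)).trans ?_
  refine Finset.prod_congr rfl fun i _ => ?_
  rw [← hθ.law i, lintegral_map (hb i) (hθ.measurable i)]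
  rfl

lemma IsUniformSeq.measurable_seq {θ : ℕ → Ω → I} (hθ : IsUniformSeq θ μ) :
    Measurable fun ω i => θ i ω := measurable_pi_lambda _ hθ.measurable

/-- Independence of the two sequences permits Fubini; within each sequence the product then
factorizes. -/
lemma lintegral_prod_uniform_pairs [IsProbabilityMeasure μ] {θ₁ θ₂ : ℕ → Ω → I}
    (h₁ : IsUniformSeq θ₁ μ) (h₂ : IsUniformSeq θ₂ μ)
    (hind : IndepFun (fun ω i => θ₁ i ω) (fun ω i => θ₂ i ω) μ) (s : Finset ℕ)
    {b : ℕ → I × I → ℝ≥0∞} (hb : ∀ i, Measurable (b i)) :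
    ∫⁻ ω, ∏ i ∈ s, b i (θ₁ i ω, θ₂ i ω) ∂μ = ∏ i ∈ s, ∫⁻ x, b i x ∂(volume.prod volume) := by
  have m₁ := h₁.measurable_seq
  have m₂ := h₂.measurable_seq
  have hmap := (indepFun_iff_map_prod_eq_prod_map_map m₁.aemeasurable m₂.aemeasurable).1 hind
  have hF : Measurable fun p : (ℕ → I) × (ℕ → I) => ∏ i ∈ s, b i (p.1 i, p.2 i) := by fun_prop
  have : IsProbabilityMeasure (μ.map fun ω i => θ₂ i ω) :=
    Measure.isProbabilityMeasure_map m₂.aemeasurable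
  have hB : ∀ i, Measurable fun x => ∫⁻ y, b i (x, y) := fun i => (hb i).lintegral_prod_right'
  calc ∫⁻ ω, ∏ i ∈ s, b i (θ₁ i ω, θ₂ i ω) ∂μ
      = ∫⁻ p, ∏ i ∈ s, b i (p.1 i, p.2 i) ∂(μ.map fun ω => ((fun i => θ₁ i ω), fun i => θ₂ i ω)) := by
        rw [lintegral_map hF (m₁.prodMk m₂)]
    _ = ∫⁻ ω, ∫⁻ ω', ∏ i ∈ s, b i (θ₁ i ω, θ₂ i ω') ∂μ ∂μ := by
        rw [hmap, lintegral_prod _ hF.aemeasurable, lintegral_map hF.lintegral_prod_right' m₁]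
        refine lintegral_congr fun ω => ?_
        exact lintegral_map (hF.comp measurable_prodMk_left) m₂
    _ = ∫⁻ ω, ∏ i ∈ s, (∫⁻ y : I, b i (θ₁ i ω, y)) ∂μ := by
        refine lintegral_congr fun ω => ?_
        exact h₂.lintegral_prod_eq s (b := fun i y => b i (θ₁ i ω, y))
          fun i => (hb i).comp measurable_prodMk_left
    _ = ∏ i ∈ s, ∫⁻ x, ∫⁻ y, b i (x, y) := h₁.lintegral_prod_eq s hB
    _ = _ := Finset.prod_congr rfl fun i _ => (lintegral_prod _ (hb i).aemeasurable).symm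

/-- Limit of the finite products. Writing the infinite product as exp(-∑ -log) covers vanishing
factors too, as -log 0 = ∞. -/
lemma lintegral_expNeg_tsum_uniform_pairs [IsProbabilityMeasure μ] {θ₁ θ₂ : ℕ → Ω → I}
    (h₁ : IsUniformSeq θ₁ μ) (h₂ : IsUniformSeq θ₂ μ)
    (hind : IndepFun (fun ω i => θ₁ i ω) (fun ω i => θ₂ i ω) μ)
    {b : ℕ → I × I → ℝ≥0∞} (hb : ∀ i, Measurable (b i)) :
    ∫⁻ ω, expNeg (∑' i, b i (θ₁ i ω, θ₂ i ω)) ∂μ =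
      expNeg (∑' i, negLog (∫⁻ x, expNeg (b i x) ∂(volume.prod volume))) := by
  have hm : ∀ i, Measurable fun ω => b i (θ₁ i ω, θ₂ i ω) := fun i =>
    (hb i).comp ((h₁.measurable i).prodMk (h₂.measurable i))
  have hleft : Filter.Tendsto
      (fun n => ∫⁻ ω, expNeg (∑ i ∈ Finset.range n, b i (θ₁ i ω, θ₂ i ω)) ∂μ) Filter.atTop
      (nhds (∫⁻ ω, expNeg (∑' i, b i (θ₁ i ω, θ₂ i ω)) ∂μ)) :=
    tendsto_lintegral_of_dominated_convergence (fun _ => 1)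
      (fun n => measurable_expNeg.comp (Finset.measurable_sum _ fun i _ => hm i))
      (fun n => ae_of_all _ fun ω => expNeg_le_one _) (by simp)
      (ae_of_all _ fun ω => (continuous_expNeg.tendsto _).comp (ENNReal.tendsto_nat_tsum _))
  have hright := (continuous_expNeg.tendsto _).comp (ENNReal.tendsto_nat_tsum
    fun i => negLog (∫⁻ x, expNeg (b i x) ∂(volume.prod volume)))
  refine tendsto_nhds_unique hleft (hright.congr fun n => ?_)
  simp only [Function.comp_apply, expNeg_sum]
  rw [lintegral_prod_uniform_pairs h₁ h₂ hind _ (b := fun i x => expNeg (b i x))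
    fun i => measurable_expNeg.comp (hb i)]
  refine Finset.prod_congr rfl fun i _ => expNeg_negLog ?_
  refine (lintegral_mono fun x => expNeg_le_one _).trans ?_
  simp

lemma lintegral_pointSum (κ : ℕ∞) (y : ℕ → E) {f : E → ℝ≥0∞} (hf : Measurable f) :
    ∫⁻ x, f x ∂(pointSum κ y) = ∑' i : ℕ, if (i : ℕ∞) < κ then f (y i) else 0 := by
  rw [pointSum, lintegral_sum_measure]
  refine tsum_congr fun i => ?_
  split_ifs
  · exact lintegral_dirac' _ hf
  · simp

lemma measurable_pointSum {κ : Ω → ℕ∞} {η : ℕ → Ω → E} (hκ : Measurable κ)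
    (hη : ∀ i, Measurable (η i)) : Measurable fun ω => pointSum (κ ω) fun i => η i ω := by
  refine Measure.measurable_of_measurable_coe _ fun A hA => ?_
  have : ∀ ω, pointSum (κ ω) (fun i => η i ω) A =
      ∑' i : ℕ, if (i : ℕ∞) < κ ω then A.indicator 1 (η i ω) else 0 := fun ω => by
    rw [← lintegral_indicator_one hA, lintegral_pointSum _ _ (measurable_one.indicator hA)]
  simp_rw [this]
  refine Measurable.tsum fun i => Measurable.ite ?_ ?_ measurable_const
  · exact hκ (MeasurableSet.of_discrete (s := {k : ℕ∞ | (i : ℕ∞) < k}))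
  · exact (measurable_one.indicator hA).comp (hη i)

/-- The Laplace functional of an independently marked Poisson process. -/
theorem IsPoissonEnumeration.laplace_marked [IsProbabilityMeasure μ] {κ : Ω → ℕ∞}
    {η : ℕ → Ω → E} {Λ : Measure E} {θ₁ θ₂ : ℕ → Ω → I} (h : IsPoissonEnumeration κ η Λ μ)
    (h₁ : IsUniformSeq θ₁ μ) (h₂ : IsUniformSeq θ₂ μ)
    (hind : IndepFun (fun ω i => θ₁ i ω) (fun ω i => θ₂ i ω) μ)
    (hind' : IndepFun (fun ω => (κ ω, fun i => η i ω))
      (fun ω => (fun i => θ₁ i ω, fun i => θ₂ i ω)) μ)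
    {F : E × (I × I) → ℝ≥0∞} (hF : Measurable F) :
    ∫⁻ ω, expNeg (∑' i : ℕ, if (i : ℕ∞) < κ ω then F (η i ω, (θ₁ i ω, θ₂ i ω)) else 0) ∂μ =
      expNeg (∫⁻ y, ∫⁻ x, (1 - expNeg (F (y, x))) ∂(volume.prod volume) ∂Λ) := by
  have mκη : Measurable fun ω => (κ ω, fun i => η i ω) :=
    h.measurable_count.prodMk (measurable_pi_lambda _ h.measurable_point)
  have mθ : Measurable fun ω => ((fun i => θ₁ i ω), fun i => θ₂ i ω) :=
    h₁.measurable_seq.prodMk h₂.measurable_seq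
  have hmap := (indepFun_iff_map_prod_eq_prod_map_map mκη.aemeasurable mθ.aemeasurable).1 hind'
  have : IsProbabilityMeasure (μ.map fun ω => ((fun i => θ₁ i ω), fun i => θ₂ i ω)) :=
    Measure.isProbabilityMeasure_map mθ.aemeasurable
  have hΦ : Measurable fun p : (ℕ∞ × (ℕ → E)) × ((ℕ → I) × (ℕ → I)) =>
      expNeg (∑' i : ℕ, if (i : ℕ∞) < p.1.1 then F (p.1.2 i, (p.2.1 i, p.2.2 i)) else 0) := by
    refine measurable_expNeg.comp (Measurable.tsum fun i =>
      Measurable.ite ?_ (by fun_prop) measurable_const)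
    exact measurable_fst.fst (MeasurableSet.of_discrete (s := {k : ℕ∞ | (i : ℕ∞) < k}))
  have hFle : ∀ y, ∫⁻ x, expNeg (F (y, x)) ∂((volume : Measure I).prod volume) ≤ 1 := fun y =>
    (lintegral_mono fun x => expNeg_le_one _).trans (by simp)
  have hHm : Measurable fun y => negLog (∫⁻ x, expNeg (F (y, x)) ∂((volume : Measure I).prod volume)) :=
    measurable_negLog.comp (measurable_expNeg.comp hF).lintegral_prod_right'
  calc _ = ∫⁻ p, expNeg (∑' i : ℕ, if (i : ℕ∞) < p.1.1 then F (p.1.2 i, (p.2.1 i, p.2.2 i)) else 0)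
        ∂(μ.map fun ω => ((κ ω, fun i => η i ω), ((fun i => θ₁ i ω), fun i => θ₂ i ω))) := by
        rw [lintegral_map hΦ (mκη.prodMk mθ)]
    _ = ∫⁻ ω, ∫⁻ ω', expNeg (∑' i : ℕ, if (i : ℕ∞) < κ ω then F (η i ω, (θ₁ i ω', θ₂ i ω')) else 0)
          ∂μ ∂μ := by
        rw [hmap, lintegral_prod _ hΦ.aemeasurable, lintegral_map hΦ.lintegral_prod_right' mκη]
        refine lintegral_congr fun ω => ?_
        exact lintegral_map (hΦ.comp measurable_prodMk_left) mθ
    -- Averaging over the marks with the points fixed leaves exp(-∑ H(η i)) with H = -log ∫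
    -- exp(-F(·, x)) dx, to which the unmarked Laplace functional applies.
    _ = ∫⁻ ω, expNeg (∫⁻ y, negLog (∫⁻ x, expNeg (F (y, x)) ∂(volume.prod volume))
          ∂(pointSum (κ ω) fun i => η i ω)) ∂μ := by
        refine lintegral_congr fun ω => ?_
        rw [lintegral_pointSum _ _ hHm]
        have := lintegral_expNeg_tsum_uniform_pairs h₁ h₂ hind
          (b := fun i x => if (i : ℕ∞) < κ ω then F (η i ω, x) else 0) (fun i => by
            split_ifs
            · exact hF.comp measurable_prodMk_left
            · exact measurable_const)
        rw [this]
        congr 1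
        refine tsum_congr fun i => ?_
        split_ifs
        · rfl
        -- Indices beyond κ contribute -log 1 = 0.
        · simpa using negLog_expNeg 0
    _ = expNeg (∫⁻ y, (1 - ∫⁻ x, expNeg (F (y, x)) ∂(volume.prod volume)) ∂Λ) := by
        rw [h.isPoisson.laplace hHm]
        simp_rw [fun y => expNeg_negLog (hFle y)]
    _ = _ := by
        congr 1
        refine lintegral_congr fun y => ?_
        rw [lintegral_sub]
        · simp
        · exact measurable_expNeg.comp (hF.comp measurable_prodMk_left)
        · exact ne_top_of_le_ne_top ENNReal.one_ne_top (hFle y)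
        · exact ae_of_all _ fun x => expNeg_le_one _

end Marking

/-! ### Disintegration of measures with a σ-finite marginal -/

/-- A positive integrable weight in the first coordinate makes ρ finite. Such a weight does not
affect the conditional law of the second coordinate, so the kernel of the weighted measure serves
for ρ. -/
theorem exists_isMarkovKernel_compProd_eq {α β : Type*} [MeasurableSpace α] [MeasurableSpace β]
    [StandardBorelSpace β] [Nonempty β] (ρ : Measure (α × β)) [SigmaFinite ρ.fst] :
    ∃ K : Kernel α β, IsMarkovKernel K ∧ ρ = ρ.fst ⊗ₘ K := by
  obtain ⟨w, hw0, hw, hw1⟩ := exists_pos_lintegral_lt_of_sigmaFinite ρ.fst one_ne_zero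
  have hwm : Measurable fun p : α × β => (w p.1 : ℝ≥0∞) := by fun_prop
  have hwm' : Measurable fun a : α => (w a : ℝ≥0∞) := by fun_prop
  have hfin : ∫⁻ p, (w p.1 : ℝ≥0∞) ∂ρ ≠ ∞ := by
    rw [Measure.fst, lintegral_map hwm' measurable_fst] at hw1
    exact (hw1.trans ENNReal.one_lt_top).ne
  have := isFiniteMeasure_withDensity hfin
  set ρ' := ρ.withDensity fun p => (w p.1 : ℝ≥0∞) with hρ'
  have hfst : ρ'.fst = ρ.fst.withDensity fun a => (w a : ℝ≥0∞) := by
    ext s hs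
    rw [Measure.fst_apply hs, withDensity_apply _ (measurable_fst hs), withDensity_apply _ hs,
      Measure.fst, setLIntegral_map hs hwm' measurable_fst]
  refine ⟨ρ'.condKernel, inferInstance, ?_⟩
  have hcancel : ∀ a, (w a : ℝ≥0∞) * (w a : ℝ≥0∞)⁻¹ = 1 := fun a =>
    ENNReal.mul_inv_cancel (by exact_mod_cast (hw0 a).ne') ENNReal.coe_ne_top
  ext s hs
  have hm1 : Measurable (s.indicator fun p : α × β => (w p.1 : ℝ≥0∞)⁻¹) :=
    hwm.inv.indicator hs
  calc ρ s = ∫⁻ p, s.indicator (fun p => (w p.1 : ℝ≥0∞)⁻¹) p ∂ρ' := by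
        rw [hρ', lintegral_withDensity_eq_lintegral_mul _ hwm hm1, ← lintegral_indicator_one hs]
        refine lintegral_congr fun p => ?_
        by_cases hp : p ∈ s
        · simp [Set.indicator_of_mem hp, hcancel]
        · simp [Set.indicator_of_notMem hp]
    _ = ∫⁻ a, ∫⁻ b, s.indicator (fun p => (w p.1 : ℝ≥0∞)⁻¹) (a, b) ∂(ρ'.condKernel a) ∂ρ'.fst := by
        conv_lhs => rw [← ρ'.disintegrate ρ'.condKernel]
        rw [Measure.lintegral_compProd hm1]
    _ = ∫⁻ a, (w a : ℝ≥0∞)⁻¹ * ρ'.condKernel a (Prod.mk a ⁻¹' s) ∂ρ'.fst := by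
        refine lintegral_congr fun a => ?_
        rw [← lintegral_indicator_one (measurable_prodMk_left hs),
          ← lintegral_const_mul _ (measurable_one.indicator (measurable_prodMk_left hs))]
        refine lintegral_congr fun b => ?_
        by_cases hp : (a, b) ∈ s <;> simp [Set.indicator, hp]
    _ = ∫⁻ a, ρ'.condKernel a (Prod.mk a ⁻¹' s) ∂ρ.fst := by
        have hK : Measurable fun a => ρ'.condKernel a (Prod.mk a ⁻¹' s) :=
          Kernel.measurable_kernel_prodMk_left hs
        rw [hfst]
        refine (lintegral_withDensity_eq_lintegral_mul _ hwm' (hwm'.inv.mul hK)).trans ?_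
        refine lintegral_congr fun a => ?_
        simp [← mul_assoc, hcancel]
    _ = _ := (Measure.compProd_apply hs).symm

/-! ### Decomposition of the mean measure -/

section Structure

variable {E₁ E₂ E₃ : Type*} {o₁ : E₁} {o₂ : E₂} {o₃ : E₃}

lemma inclThird_injective :
    Function.Injective (inclThird : E₁ × E₂ × Punctured o₃ → Punctured (o₁, o₂, o₃)) := by
  rintro ⟨a, b, c, hc⟩ ⟨a', b', c', hc'⟩ h
  simpa [inclThird] using h

lemma range_inclThird :
    Set.range (inclThird : E₁ × E₂ × Punctured o₃ → Punctured (o₁, o₂, o₃)) =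
      {y | y.1.2.2 = o₃}ᶜ := by
  ext y
  constructor
  · rintro ⟨p, rfl⟩
    exact p.2.2.2
  · intro hy
    exact ⟨(y.1.1, y.1.2.1, ⟨y.1.2.2, hy⟩), rfl⟩

variable [MeasurableSpace E₁] [MeasurableSpace E₂] [MeasurableSpace E₃]

@[fun_prop] lemma measurable_coord₁ : Measurable fun y : Punctured (o₁, o₂, o₃) => y.1.1 :=
  measurable_subtype_coe.fst

@[fun_prop] lemma measurable_coord₂ : Measurable fun y : Punctured (o₁, o₂, o₃) => y.1.2.1 :=
  measurable_subtype_coe.snd.fst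

@[fun_prop] lemma measurable_coord₃ : Measurable fun y : Punctured (o₁, o₂, o₃) => y.1.2.2 :=
  measurable_subtype_coe.snd.snd

lemma measurable_inclThird :
    Measurable (inclThird : E₁ × E₂ × Punctured o₃ → Punctured (o₁, o₂, o₃)) := by
  refine Measurable.subtype_mk ?_
  exact measurable_fst.prodMk
    (measurable_snd.fst.prodMk (measurable_subtype_coe.comp measurable_snd.snd))

/-- The rearrangement of the coordinates which puts the third one first. -/
def thirdFirst (p : E₁ × E₂ × Punctured o₃) : Punctured o₃ × (E₁ × E₂) := (p.2.2, p.1, p.2.1)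

lemma measurable_thirdFirst :
    Measurable (thirdFirst : E₁ × E₂ × Punctured o₃ → Punctured o₃ × (E₁ × E₂)) := by
  unfold thirdFirst; fun_prop

lemma measurable_padd {E : Type*} [MeasurableSpace E] [MeasurableSingletonClass E] (o : E) :
    Measurable fun p : E × E => padd o p.1 p.2 := by
  classical
  exact Measurable.ite (measurable_fst (measurableSet_singleton o)) measurable_snd measurable_fst

variable {h₁ : E₃ × I → E₁} {h₂ : E₃ × I → E₂}

/-- The product of the laws of `h₁ (y₃, ·)` and `h₂ (y₃, ·)` as a kernel. -/
def representKernel (o₃ : E₃) (_ : Measurable h₁) (_ : Measurable h₂) :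
    Kernel (Punctured o₃) (E₁ × E₂) :=
  (Kernel.id ×ₖ Kernel.const (Punctured o₃) ((volume : Measure I).prod volume)).map
    fun q => (h₁ (q.1.1, q.2.1), h₂ (q.1.1, q.2.2))

lemma representKernel_apply (m₁ : Measurable h₁) (m₂ : Measurable h₂) (y₃ : Punctured o₃) :
    representKernel o₃ m₁ m₂ y₃ = ((volume : Measure I).map fun s => h₁ (y₃.1, s)).prod
      ((volume : Measure I).map fun t => h₂ (y₃.1, t)) := by
  have hm : Measurable fun q : Punctured o₃ × (I × I) =>
      (h₁ (q.1.1, q.2.1), h₂ (q.1.1, q.2.2)) := by fun_prop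
  rw [representKernel, Kernel.map_apply _ hm, Kernel.prod_apply, Kernel.id_apply,
    Kernel.const_apply, Measure.dirac_prod, Measure.map_map hm measurable_prodMk_left,
    Measure.map_prod_map _ _ (by fun_prop) (by fun_prop)]
  rfl

instance (m₁ : Measurable h₁) (m₂ : Measurable h₂) :
    IsMarkovKernel (representKernel o₃ m₁ m₂) := by
  have hm : Measurable fun q : Punctured o₃ × (I × I) =>
      (h₁ (q.1.1, q.2.1), h₂ (q.1.1, q.2.2)) := by fun_prop
  exact Kernel.IsMarkovKernel.map _ hm

lemma lintegral_representKernel (m₁ : Measurable h₁) (m₂ : Measurable h₂) (y₃ : Punctured o₃)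
    {f : E₁ × E₂ → ℝ≥0∞} (hf : Measurable f) :
    ∫⁻ p, f p ∂(representKernel o₃ m₁ m₂ y₃) =
      ∫⁻ x, f (h₁ (y₃.1, x.1), h₂ (y₃.1, x.2)) ∂((volume : Measure I).prod volume) := by
  rw [representKernel_apply, Measure.map_prod_map _ _ (by fun_prop) (by fun_prop),
    lintegral_map hf (by fun_prop)]
  rfl

/-! ### Disintegration off {y₃ = o₃} -/

section Singleton

variable [MeasurableSingletonClass E₃]

lemma measurableSet_third : MeasurableSet {y : Punctured (o₁, o₂, o₃) | y.1.2.2 = o₃} :=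
  measurable_coord₃ (measurableSet_singleton o₃)

lemma measurableSet_first_third [MeasurableSingletonClass E₁] :
    MeasurableSet {y : Punctured (o₁, o₂, o₃) | y.1.1 = o₁ ∧ y.1.2.2 = o₃} :=
  (measurable_coord₁ (measurableSet_singleton o₁)).inter measurableSet_third

lemma measurableSet_second_third [MeasurableSingletonClass E₂] :
    MeasurableSet {y : Punctured (o₁, o₂, o₃) | y.1.2.1 = o₂ ∧ y.1.2.2 = o₃} :=
  (measurable_coord₂ (measurableSet_singleton o₂)).inter measurableSet_third

lemma measurableEmbedding_inclThird :
    MeasurableEmbedding (inclThird : E₁ × E₂ × Punctured o₃ → Punctured (o₁, o₂, o₃)) := by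
  refine MeasurableEmbedding.of_measurable_inverse_on_range measurable_inclThird
    (by rw [range_inclThird]; exact measurableSet_third.compl)
    (g := fun z => (z.1.1.1, z.1.1.2.1, ⟨z.1.1.2.2, range_inclThird.subset z.2⟩)) ?_ ?_
  · refine (measurable_coord₁.comp measurable_subtype_coe).prodMk
      ((measurable_coord₂.comp measurable_subtype_coe).prodMk (Measurable.subtype_mk ?_))
    exact measurable_coord₃.comp measurable_subtype_coe
  · rintro ⟨a, b, c⟩
    rfl

lemma measurableEmbedding_punctured :
    MeasurableEmbedding (Subtype.val : Punctured o₃ → E₃) :=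
  MeasurableEmbedding.subtype_coe (measurableSet_singleton o₃).compl

lemma map_restrictThird (Λ : Measure (Punctured (o₁, o₂, o₃))) :
    (restrictThird Λ).map inclThird = Λ.restrict {y | y.1.2.2 = o₃}ᶜ := by
  rw [restrictThird, measurableEmbedding_inclThird.map_comap, range_inclThird]

lemma marginal₃_eq_map (Λ : Measure (Punctured (o₁, o₂, o₃))) :
    marginal₃ Λ = (restrictThird Λ).map fun p => p.2.2 := by
  ext C hC
  rw [Measure.map_apply measurable_snd.snd hC, marginal₃, restrictThird,
    measurableEmbedding_punctured.comap_apply, measurableEmbedding_inclThird.comap_apply, proj₃,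
    Measure.map_apply measurable_coord₃ (measurableEmbedding_punctured.measurableSet_image' hC)]
  congr 1
  ext y
  constructor
  · rintro ⟨c, hc, hcy⟩
    exact ⟨(y.1.1, y.1.2.1, c), hc, Subtype.ext (Prod.ext rfl (Prod.ext rfl hcy))⟩
  · rintro ⟨p, hp, rfl⟩
    exact ⟨p.2.2, hp, rfl⟩

variable {Λ : Measure (Punctured (o₁, o₂, o₃))}

/-- The cylinder over L₃ h is part of the h-th localizing set of the product. -/
lemma sigmaFinite_marginal₃ {L₁ : ℕ → Set E₁} {L₂ : ℕ → Set E₂} {L₃ : ℕ → Set E₃}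
    (hL₃ : IsLocalizing o₃ L₃) (hΛ : ∀ h, Λ (localizingProd L₁ L₂ L₃ h) < ∞) :
    SigmaFinite (marginal₃ Λ) := by
  refine ⟨⟨⟨fun h => Subtype.val ⁻¹' L₃ h, fun _ => trivial, fun h => ?_, ?_⟩⟩⟩
  · rw [marginal₃, measurableEmbedding_punctured.comap_apply, proj₃]
    refine lt_of_le_of_lt (measure_mono (Set.image_preimage_subset _ _)) ?_
    rw [Measure.map_apply measurable_coord₃ (hL₃.measurableSet h)]
    exact lt_of_le_of_lt (measure_mono fun y hy => Or.inr (Or.inr hy)) (hΛ h)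
  · rw [← Set.preimage_iUnion, hL₃.iUnion_eq]
    exact Set.eq_univ_of_forall fun y => y.2

omit [MeasurableSingletonClass E₃] in
-- The coordinates are rearranged because the base comes first in `⊗ₘ`.
lemma isDisintegration_iff [SFinite (marginal₃ Λ)] (K : Kernel (Punctured o₃) (E₁ × E₂)) :
    IsDisintegration Λ K ↔
      IsMarkovKernel K ∧ (restrictThird Λ).map thirdFirst = marginal₃ Λ ⊗ₘ K := by
  refine and_congr_right fun hK => ?_
  constructor
  · intro h
    ext A hA
    rw [Measure.map_apply measurable_thirdFirst hA, h _ (measurable_thirdFirst hA),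
      Measure.compProd_apply hA]
    rfl
  · intro h A hA
    have e : A = thirdFirst ⁻¹' {q : Punctured o₃ × (E₁ × E₂) | (q.2.1, q.2.2, q.1) ∈ A} := rfl
    have hm : MeasurableSet {q : Punctured o₃ × (E₁ × E₂) | (q.2.1, q.2.2, q.1) ∈ A} := by
      have : Measurable fun q : Punctured o₃ × (E₁ × E₂) => (q.2.1, q.2.2, q.1) := by fun_prop
      exact this hA
    conv_lhs => rw [e, ← Measure.map_apply measurable_thirdFirst hm, h, Measure.compProd_apply hm]
    rfl

lemma exists_isDisintegration [StandardBorelSpace E₁] [StandardBorelSpace E₂]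
    [SigmaFinite (marginal₃ Λ)] : ∃ K, IsDisintegration Λ K := by
  have hfst : ((restrictThird Λ).map thirdFirst).fst = marginal₃ Λ := by
    rw [Measure.fst, Measure.map_map measurable_fst measurable_thirdFirst, marginal₃_eq_map]
    rfl
  have : SigmaFinite ((restrictThird Λ).map thirdFirst).fst := by rw [hfst]; infer_instance
  have : Nonempty (E₁ × E₂) := ⟨(o₁, o₂)⟩
  obtain ⟨K, hK, h⟩ := exists_isMarkovKernel_compProd_eq ((restrictThird Λ).map thirdFirst)
  rw [hfst] at h
  exact ⟨K, (isDisintegration_iff K).2 ⟨hK, h⟩⟩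

lemma IsDisintegration.lintegral_eq [SFinite (marginal₃ Λ)]
    {K : Kernel (Punctured o₃) (E₁ × E₂)} (hK : IsDisintegration Λ K)
    {φ : Punctured (o₁, o₂, o₃) → ℝ≥0∞} (hφ : Measurable φ) :
    ∫⁻ y, φ y ∂Λ = ∫⁻ y in {y | y.1.2.2 = o₃}, φ y ∂Λ +
      ∫⁻ y₃, ∫⁻ p, φ (inclThird (p.1, p.2, y₃)) ∂(K y₃) ∂(marginal₃ Λ) := by
  have := hK.1
  rw [← lintegral_add_compl φ measurableSet_third, ← map_restrictThird,
    lintegral_map hφ measurable_inclThird]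
  congr 1
  have hm : Measurable fun q : Punctured o₃ × (E₁ × E₂) =>
      φ (inclThird (q.2.1, q.2.2, q.1)) := by
    refine hφ.comp (measurable_inclThird.comp ?_)
    fun_prop
  rw [← Measure.lintegral_compProd hm, ← ((isDisintegration_iff K).1 hK).2,
    lintegral_map hm measurable_thirdFirst]
  rfl

end Singleton

variable [MeasurableSingletonClass E₁] [MeasurableSingletonClass E₂]
  [MeasurableSingletonClass E₃] {Λ : Measure (Punctured (o₁, o₂, o₃))}

omit [MeasurableSingletonClass E₂] in
/-- If no mass sits at points with `y₁ ≠ o₁`, `y₂ ≠ o₂`, `y₃ = o₃`, then `Λ` is carried by the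
first two axes on `{y₃ = o₃}`. -/
lemma setLIntegral_third_eq (h : Λ {y | y.1.1 ≠ o₁ ∧ y.1.2.1 ≠ o₂ ∧ y.1.2.2 = o₃} = 0)
    (φ : Punctured (o₁, o₂, o₃) → ℝ≥0∞) :
    ∫⁻ y in {y | y.1.2.2 = o₃}, φ y ∂Λ =
      ∫⁻ y in {y | y.1.2.1 = o₂ ∧ y.1.2.2 = o₃}, φ y ∂Λ +
      ∫⁻ y in {y | y.1.1 = o₁ ∧ y.1.2.2 = o₃}, φ y ∂Λ := by
  have hdisj : Disjoint {y : Punctured (o₁, o₂, o₃) | y.1.2.1 = o₂ ∧ y.1.2.2 = o₃}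
      {y | y.1.1 = o₁ ∧ y.1.2.2 = o₃} := Set.disjoint_left.2 fun y h2 h1 =>
    y.2 (Prod.ext h1.1 (Prod.ext h2.1 h1.2))
  rw [← lintegral_union measurableSet_first_third hdisj]
  refine setLIntegral_congr ?_
  have : ∀ᵐ y ∂Λ, ¬ (y.1.1 ≠ o₁ ∧ y.1.2.1 ≠ o₂ ∧ y.1.2.2 = o₃) := by
    rw [ae_iff]; simpa using h
  filter_upwards [this] with y hy
  apply propext
  change y.1.2.2 = o₃ ↔ (y.1.2.1 = o₂ ∧ y.1.2.2 = o₃) ∨ (y.1.1 = o₁ ∧ y.1.2.2 = o₃)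
  tauto

/-! ### The representing measure -/

omit [MeasurableSingletonClass E₃] in
lemma measurable_representPoint (m₁ : Measurable h₁) (m₂ : Measurable h₂)
    (hh₁ : ∀ s, h₁ (o₃, s) = o₁) (hh₂ : ∀ t, h₂ (o₃, t) = o₂) :
    Measurable fun p : Punctured (o₁, o₂, o₃) × (I × I) =>
      representPoint h₁ h₂ hh₁ hh₂ p.1 p.2.1 p.2.2 := by
  refine Measurable.subtype_mk (Measurable.prodMk ?_ (Measurable.prodMk ?_ ?_))
  · refine (measurable_padd o₁).comp (Measurable.prodMk (m₁.comp ?_) ?_) <;> fun_prop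
  · refine (measurable_padd o₂).comp (Measurable.prodMk (m₂.comp ?_) ?_) <;> fun_prop
  · fun_prop

/-- Points over o₃ are left unchanged by the marks, because h₁ and h₂ take the neutral values there.
A point (o₁, o₂, y₃) moves to (h₁(y₃, s), h₂(y₃, t), y₃), whose first two coordinates have law
`representKernel`. -/
lemma lintegral_extremalIndep_representPoint (m₁ : Measurable h₁) (m₂ : Measurable h₂)
    (hh₁ : ∀ s, h₁ (o₃, s) = o₁) (hh₂ : ∀ t, h₂ (o₃, t) = o₂)
    {φ : Punctured (o₁, o₂, o₃) → ℝ≥0∞} (hφ : Measurable φ) :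
    ∫⁻ y, ∫⁻ x, φ (representPoint h₁ h₂ hh₁ hh₂ y x.1 x.2) ∂((volume : Measure I).prod volume)
        ∂(extremalIndep Λ) =
      ∫⁻ y in {y | y.1.2.1 = o₂ ∧ y.1.2.2 = o₃}, φ y ∂Λ +
      ∫⁻ y in {y | y.1.1 = o₁ ∧ y.1.2.2 = o₃}, φ y ∂Λ +
      ∫⁻ y₃, ∫⁻ p, φ (inclThird (p.1, p.2, y₃)) ∂(representKernel o₃ m₁ m₂ y₃) ∂(marginal₃ Λ) := by
  have hm := hφ.comp (measurable_representPoint m₁ m₂ hh₁ hh₂)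
  have axis : Measurable (axis₃ : Punctured o₃ → Punctured (o₁, o₂, o₃)) :=
    measurable_inclThird.comp (measurable_const.prodMk (measurable_const.prodMk measurable_id))
  have fixed : ∀ y : Punctured (o₁, o₂, o₃), y.1.2.2 = o₃ → ∀ x : I × I,
      representPoint h₁ h₂ hh₁ hh₂ y x.1 x.2 = y := fun y hy x => by
    refine Subtype.ext (Prod.ext ?_ (Prod.ext ?_ rfl))
    · simp [representPoint, padd, hy, hh₁]
    · simp [representPoint, padd, hy, hh₂]
  have haxis : ∀ (y₃ : Punctured o₃) (x : I × I),
      representPoint h₁ h₂ hh₁ hh₂ (axis₃ y₃) x.1 x.2 =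
        inclThird (h₁ (y₃.1, x.1), h₂ (y₃.1, x.2), y₃) := fun y₃ x => by
    refine Subtype.ext (Prod.ext ?_ (Prod.ext ?_ rfl))
    · simp only [representPoint, axis₃, inclThird, padd]; split_ifs with h <;> simp [h]
    · simp only [representPoint, axis₃, inclThird, padd]; split_ifs with h <;> simp [h]
  rw [extremalIndep, lintegral_add_measure, lintegral_add_measure]
  have e := lintegral_map (μ := marginal₃ Λ) (hm.lintegral_prod_right'
    (ν := (volume : Measure I).prod volume)) axis
  simp only [Function.comp_apply, haxis] at e
  rw [e]
  congr 1
  · congr 1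
    · refine setLIntegral_congr_fun measurableSet_second_third fun y hy => ?_
      simp [fixed y hy.2]
    · refine setLIntegral_congr_fun measurableSet_first_third fun y hy => ?_
      simp [fixed y hy.2]
  · refine lintegral_congr fun y₃ => ?_
    rw [lintegral_representKernel m₁ m₂ y₃ (f := fun p => φ (inclThird (p.1, p.2, y₃)))
      (hφ.comp (measurable_inclThird.comp (by fun_prop)))]

end Structure

/-! ### Laplace functionals conditionally on the third projection -/

section ThirdProjection

/-- This is where the dichotomy 0 or ∞ enters. If the mass is ∞ and a ≠ 0, both sides are exp(-∞) =
0; the remaining cases are trivial. -/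
lemma expNeg_lintegral_add_const {α : Type*} [MeasurableSpace α] {M : Measure α}
    (hM : M Set.univ = 0 ∨ M Set.univ = ∞) (F : α → ℝ≥0∞) (a : ℝ≥0∞) :
    expNeg (∫⁻ y, (1 - expNeg (F y + a)) ∂M) =
      expNeg (∫⁻ y, (1 - expNeg (F y)) ∂M) * expNeg (∫⁻ _, (1 - expNeg a) ∂M) := by
  rcases hM with hM | hM
  · simp [Measure.measure_univ_eq_zero.1 hM]
  · rcases eq_or_ne a 0 with rfl | ha
    · simp
    · have htop : ∫⁻ _, (1 - expNeg a) ∂M = ∞ := by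
        rw [lintegral_const, hM, ENNReal.mul_top]
        rw [Ne, tsub_eq_zero_iff_le, not_le]
        exact lt_of_le_of_ne (expNeg_le_one a) fun h => ha (expNeg_eq_one.1 h)
      have htop' : ∫⁻ y, (1 - expNeg (F y + a)) ∂M = ∞ := by
        refine top_le_iff.1 (htop ▸ lintegral_mono fun y => ?_)
        exact tsub_le_tsub_left (expNeg_antitone le_add_self) 1
      rw [htop, htop', expNeg_top, mul_zero]

variable {E₁ E₂ E₃ : Type*} [MeasurableSpace E₁] [MeasurableSpace E₂] [MeasurableSpace E₃]
  {o₁ : E₁} {o₂ : E₂} {o₃ : E₃}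

lemma measurable_proj₁ :
    Measurable (proj₁ : Measure (Punctured (o₁, o₂, o₃)) → Measure E₁) :=
  Measure.measurable_map _ measurable_coord₁

lemma measurable_proj₂ :
    Measurable (proj₂ : Measure (Punctured (o₁, o₂, o₃)) → Measure E₂) :=
  Measure.measurable_map _ measurable_coord₂

lemma measurable_proj₃ :
    Measurable (proj₃ : Measure (Punctured (o₁, o₂, o₃)) → Measure E₃) :=
  Measure.measurable_map _ measurable_coord₃

/-- The factor contributed by `{y₃ = o₃}` to the Laplace functional, conditionally on the third
projection. -/
def axisFactor (Λ : Measure (Punctured (o₁, o₂, o₃))) (F : E₁ × E₂ → ℝ≥0∞) : ℝ≥0∞ :=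
  expNeg (∫⁻ y in {y | y.1.2.2 = o₃}, (1 - expNeg (F (y.1.1, y.1.2.1))) ∂Λ)

open Classical in
/-- The function `y₃ ↦ -log ∫ exp (-F) dK(y₃)`, extended by `0` to `o₃`. -/
def kernelExponent (K : Kernel (Punctured o₃) (E₁ × E₂)) (F : E₁ × E₂ → ℝ≥0∞) (z : E₃) : ℝ≥0∞ :=
  if h : z = o₃ then 0 else negLog (∫⁻ p, expNeg (F p) ∂(K ⟨z, h⟩))

variable {K : Kernel (Punctured o₃) (E₁ × E₂)} {F : E₁ × E₂ → ℝ≥0∞}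

@[simp] lemma kernelExponent_base : kernelExponent K F o₃ = 0 := by simp [kernelExponent]

lemma expNeg_kernelExponent [IsMarkovKernel K] (y₃ : Punctured o₃) :
    expNeg (kernelExponent K F y₃.1) = ∫⁻ p, expNeg (F p) ∂(K y₃) := by
  rw [kernelExponent, dif_neg y₃.2, expNeg_negLog]
  exact (lintegral_mono fun x => expNeg_le_one _).trans (by simp)

lemma measurable_kernelExponent [MeasurableSingletonClass E₃] (hF : Measurable F) :
    Measurable (kernelExponent K F) := by
  classical
  have h := Measurable.dite (s := ({o₃} : Set E₃)) (f := fun _ => (0 : ℝ≥0∞)) measurable_const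
    (g := fun z => negLog (∫⁻ p, expNeg (F p) ∂(K ⟨z.1, z.2⟩)))
    (measurable_negLog.comp ((measurable_expNeg.comp hF).lintegral_kernel))
    (measurableSet_singleton o₃)
  exact h

variable [MeasurableSingletonClass E₃] {Λ : Measure (Punctured (o₁, o₂, o₃))}
  {Ω : Type*} [MeasurableSpace Ω] {μ : Measure Ω} [IsProbabilityMeasure μ]
  {ξ : Ω → Measure (Punctured (o₁, o₂, o₃))}

/-- On {y₃ = o₃} the function f is the constant f(o₃), which decouples from F by
`expNeg_lintegral_add_const`. Elsewhere K is integrated out. -/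
theorem IsPoissonProcess.laplace_proj₃ (hξ : IsPoissonProcess ξ Λ μ) [SFinite (marginal₃ Λ)]
    (hΛ₃ : Λ {y | y.1.2.2 = o₃} = 0 ∨ Λ {y | y.1.2.2 = o₃} = ∞)
    (hK : IsDisintegration Λ K) (hF : Measurable F) {f : E₃ → ℝ≥0∞} (hf : Measurable f) :
    ∫⁻ ω, expNeg (∫⁻ y, F (y.1.1, y.1.2.1) ∂(ξ ω)) * expNeg (∫⁻ z, f z ∂(proj₃ (ξ ω))) ∂μ =
      axisFactor Λ F * expNeg (∫⁻ _ in {y | y.1.2.2 = o₃}, (1 - expNeg (f o₃)) ∂Λ) *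
        expNeg (∫⁻ y₃, (1 - (∫⁻ p, expNeg (F p) ∂(K y₃)) * expNeg (f y₃.1)) ∂(marginal₃ Λ)) := by
  have := hK.1
  have hF' : Measurable fun y : Punctured (o₁, o₂, o₃) => F (y.1.1, y.1.2.1) :=
    hF.comp (by fun_prop)
  have hf' : Measurable fun y : Punctured (o₁, o₂, o₃) => f y.1.2.2 := hf.comp measurable_coord₃
  have e : ∀ ω, expNeg (∫⁻ y, F (y.1.1, y.1.2.1) ∂(ξ ω)) * expNeg (∫⁻ z, f z ∂(proj₃ (ξ ω))) =
      expNeg (∫⁻ y, (F (y.1.1, y.1.2.1) + f y.1.2.2) ∂(ξ ω)) := fun ω => by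
    rw [proj₃, lintegral_map hf measurable_coord₃, lintegral_add_left hF', expNeg_add]
  simp_rw [e]
  have hs : Measurable fun y : Punctured (o₁, o₂, o₃) => F (y.1.1, y.1.2.1) + f y.1.2.2 :=
    hF'.add hf'
  rw [hξ.laplace hs, hK.lintegral_eq (by fun_prop), expNeg_add]
  congr 1
  · rw [axisFactor, ← expNeg_lintegral_add_const (by simpa using hΛ₃)]
    congr 1
    exact setLIntegral_congr_fun measurableSet_third fun y hy => by
      rw [show y.1.2.2 = o₃ from hy]
  · congr 1
    refine lintegral_congr fun y₃ => ?_
    have hle : ∫⁻ p, expNeg (F p) ∂(K y₃) ≤ 1 :=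
      (lintegral_mono fun x => expNeg_le_one _).trans (by simp)
    simp only [inclThird, expNeg_add]
    rw [lintegral_sub (by fun_prop), lintegral_mul_const _ (by fun_prop)]
    · simp
    · rw [lintegral_mul_const _ (by fun_prop)]
      exact ENNReal.mul_ne_top (ne_top_of_le_ne_top ENNReal.one_ne_top hle) (expNeg_ne_top _)
    · exact ae_of_all _ fun p => mul_le_one' (expNeg_le_one _) (expNeg_le_one _)

/-- The Laplace functional conditionally on the third projection. -/
theorem IsPoissonProcess.condLaplace_proj₃ (hξ : IsPoissonProcess ξ Λ μ) [SFinite (marginal₃ Λ)]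
    (hΛ₃ : Λ {y | y.1.2.2 = o₃} = 0 ∨ Λ {y | y.1.2.2 = o₃} = ∞)
    (hK : IsDisintegration Λ K) (hF : Measurable F) {f : E₃ → ℝ≥0∞} (hf : Measurable f) :
    ∫⁻ ω, expNeg (∫⁻ y, F (y.1.1, y.1.2.1) ∂(ξ ω)) * expNeg (∫⁻ z, f z ∂(proj₃ (ξ ω))) ∂μ =
      ∫⁻ ω, axisFactor Λ F * expNeg (∫⁻ z, kernelExponent K F z ∂(proj₃ (ξ ω))) *
        expNeg (∫⁻ z, f z ∂(proj₃ (ξ ω))) ∂μ := by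
  have := hK.1
  have hg := measurable_kernelExponent (K := K) hF
  -- The right side is the Laplace functional of ξ₃ at `kernelExponent` + f. As `kernelExponent`
  -- vanishes at o₃, the factor from {y₃ = o₃} involves f(o₃) alone.
  have h0 := hξ.laplace_proj₃ hΛ₃ hK (F := fun _ => 0) measurable_const (hg.add hf)
  simp only [lintegral_zero, expNeg_zero, one_mul, axisFactor, tsub_self, lintegral_const,
    measure_univ, Pi.add_apply, kernelExponent_base, zero_add] at h0
  have e : ∀ ω, axisFactor Λ F * expNeg (∫⁻ z, kernelExponent K F z ∂(proj₃ (ξ ω))) *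
        expNeg (∫⁻ z, f z ∂(proj₃ (ξ ω))) =
      axisFactor Λ F * expNeg (∫⁻ z, (kernelExponent K F z + f z) ∂(proj₃ (ξ ω))) := fun ω => by
    rw [lintegral_add_left hg, expNeg_add, mul_assoc]
  simp_rw [e]
  have hm : Measurable fun ω =>
      expNeg (∫⁻ z, (kernelExponent K F z + f z) ∂(proj₃ (ξ ω))) :=
    (measurable_expNeg_lintegral (hg.add hf)).comp (measurable_proj₃.comp hξ.measurable)
  rw [lintegral_const_mul _ hm, h0, hξ.laplace_proj₃ hΛ₃ hK hF hf]
  simp only [expNeg_add, expNeg_kernelExponent, lintegral_const, mul_assoc]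

/-! ### From independent kernels to conditional independence -/

omit [MeasurableSingletonClass E₃] in
lemma axisFactor_le_one : axisFactor Λ F ≤ 1 := expNeg_le_one _

/-- On the first axis f₂ is the constant f₂(o₂), on the second f₁ is the constant f₁(o₁). Each axis
has mass 0 or ∞, so these constants decouple. -/
lemma axisFactor_add [MeasurableSingletonClass E₁] [MeasurableSingletonClass E₂]
    (hΛ₁ : Λ {y | y.1.1 = o₁ ∧ y.1.2.2 = o₃} = 0 ∨ Λ {y | y.1.1 = o₁ ∧ y.1.2.2 = o₃} = ∞)
    (hΛ₂ : Λ {y | y.1.2.1 = o₂ ∧ y.1.2.2 = o₃} = 0 ∨ Λ {y | y.1.2.1 = o₂ ∧ y.1.2.2 = o₃} = ∞)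
    (h : Λ {y | y.1.1 ≠ o₁ ∧ y.1.2.1 ≠ o₂ ∧ y.1.2.2 = o₃} = 0)
    (f₁ : E₁ → ℝ≥0∞) (f₂ : E₂ → ℝ≥0∞) :
    axisFactor Λ (fun p => f₁ p.1 + f₂ p.2) =
      axisFactor Λ (fun p => f₁ p.1) * axisFactor Λ (fun p => f₂ p.2) := by
  have e₂ : ∀ G : E₁ × E₂ → ℝ≥0∞,
      ∫⁻ y in {y | y.1.2.1 = o₂ ∧ y.1.2.2 = o₃}, (1 - expNeg (G (y.1.1, y.1.2.1))) ∂Λ =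
      ∫⁻ y in {y | y.1.2.1 = o₂ ∧ y.1.2.2 = o₃}, (1 - expNeg (G (y.1.1, o₂))) ∂Λ := fun G =>
    setLIntegral_congr_fun measurableSet_second_third fun y hy => by simp only [hy.1]
  have e₁ : ∀ G : E₁ × E₂ → ℝ≥0∞,
      ∫⁻ y in {y | y.1.1 = o₁ ∧ y.1.2.2 = o₃}, (1 - expNeg (G (y.1.1, y.1.2.1))) ∂Λ =
      ∫⁻ y in {y | y.1.1 = o₁ ∧ y.1.2.2 = o₃}, (1 - expNeg (G (o₁, y.1.2.1))) ∂Λ := fun G =>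
    setLIntegral_congr_fun measurableSet_first_third fun y hy => by simp only [hy.1]
  have a₁ := e₁ fun p => f₁ p.1 + f₂ p.2
  have a₂ := e₂ fun p => f₁ p.1 + f₂ p.2
  have b₁ := e₁ fun p => f₁ p.1
  have b₂ := e₂ fun p => f₂ p.2
  have k₂ := expNeg_lintegral_add_const (M := Λ.restrict {y | y.1.2.1 = o₂ ∧ y.1.2.2 = o₃})
    (by simpa using hΛ₂) (fun y => f₁ y.1.1) (f₂ o₂)
  have k₁ := expNeg_lintegral_add_const (M := Λ.restrict {y | y.1.1 = o₁ ∧ y.1.2.2 = o₃})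
    (by simpa using hΛ₁) (fun y => f₂ y.1.2.1) (f₁ o₁)
  simp only [expNeg_add] at a₁ a₂ b₁ b₂ k₁ k₂
  simp only [mul_comm (expNeg (f₂ _)) (expNeg (f₁ _))] at k₁
  simp only [axisFactor, setLIntegral_third_eq h, expNeg_add]
  rw [a₁, a₂, b₁, b₂, k₁, k₂]
  ring

lemma lintegral_expNeg_add_of_prod {κ : Measure (E₁ × E₂)} [IsProbabilityMeasure κ]
    (h : κ = κ.fst.prod κ.snd) {f₁ : E₁ → ℝ≥0∞} {f₂ : E₂ → ℝ≥0∞} (hf₁ : Measurable f₁)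
    (hf₂ : Measurable f₂) :
    ∫⁻ p, expNeg (f₁ p.1 + f₂ p.2) ∂κ =
      (∫⁻ p, expNeg (f₁ p.1) ∂κ) * ∫⁻ p, expNeg (f₂ p.2) ∂κ := by
  have m₁ : Measurable fun x => expNeg (f₁ x) := by fun_prop
  have m₂ : Measurable fun x => expNeg (f₂ x) := by fun_prop
  simp only [expNeg_add]
  conv_lhs => rw [h]
  rw [lintegral_prod_mul m₁.aemeasurable m₂.aemeasurable, Measure.fst, Measure.snd,
    lintegral_map m₁ measurable_fst, lintegral_map m₂ measurable_snd]

/-- The functional of ξ₁ given ξ₃ has the form c · exp(-∫ g dξ₃), and it also serves as the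
functional given (ξ₂, ξ₃). -/
theorem IsPoissonProcess.condIndep_of_kernel [MeasurableSingletonClass E₁]
    [MeasurableSingletonClass E₂] (hξ : IsPoissonProcess ξ Λ μ) [SFinite (marginal₃ Λ)]
    (hΛ₁ : Λ {y | y.1.1 = o₁ ∧ y.1.2.2 = o₃} = 0 ∨ Λ {y | y.1.1 = o₁ ∧ y.1.2.2 = o₃} = ∞)
    (hΛ₂ : Λ {y | y.1.2.1 = o₂ ∧ y.1.2.2 = o₃} = 0 ∨ Λ {y | y.1.2.1 = o₂ ∧ y.1.2.2 = o₃} = ∞)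
    (hΛ₃ : Λ {y | y.1.2.2 = o₃} = 0 ∨ Λ {y | y.1.2.2 = o₃} = ∞)
    (hK : IsDisintegration Λ K)
    (hprod : ∀ᵐ y₃ ∂(marginal₃ Λ), K y₃ = (K.fst y₃).prod (K.snd y₃))
    (hnull : Λ {y | y.1.1 ≠ o₁ ∧ y.1.2.1 ≠ o₂ ∧ y.1.2.2 = o₃} = 0) :
    CondIndep (fun ω => proj₁ (ξ ω)) (fun ω => proj₂ (ξ ω)) (fun ω => proj₃ (ξ ω)) μ := by
  have := hK.1
  have mZ := measurable_proj₃.comp hξ.measurable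
  refine condIndep_of_laplace (measurable_proj₁.comp hξ.measurable)
    (measurable_proj₂.comp hξ.measurable) mZ fun f₁ hf₁ => ?_
  have hF₁ : Measurable fun p : E₁ × E₂ => f₁ p.1 := hf₁.comp measurable_fst
  have hg := measurable_kernelExponent (K := K) hF₁
  refine ⟨axisFactor Λ fun p => f₁ p.1, kernelExponent K fun p => f₁ p.1, axisFactor_le_one, hg,
    fun f₂ f₃ hf₂ hf₃ => ?_⟩
  have hF₂ : Measurable fun p : E₁ × E₂ => f₂ p.2 := hf₂.comp measurable_snd
  have p₁ : ∀ ω, ∫⁻ y, f₁ y ∂(proj₁ (ξ ω)) = ∫⁻ y, f₁ y.1.1 ∂(ξ ω) := fun ω =>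
    lintegral_map hf₁ measurable_coord₁
  have p₂ : ∀ ω, ∫⁻ y, f₂ y ∂(proj₂ (ξ ω)) = ∫⁻ y, f₂ y.1.2.1 ∂(ξ ω) := fun ω =>
    lintegral_map hf₂ measurable_coord₂
  -- `L` evaluates the left side; in `R`, g is absorbed into the function of y₃. They match once K
  -- and `axisFactor` factorize.
  have L := hξ.laplace_proj₃ hΛ₃ hK (F := fun p => f₁ p.1 + f₂ p.2) (by fun_prop) hf₃
  have R := hξ.laplace_proj₃ hΛ₃ hK hF₂ (hg.add hf₃)
  have l : ∀ ω, expNeg (∫⁻ y, f₁ y ∂(proj₁ (ξ ω))) * expNeg (∫⁻ y, f₂ y ∂(proj₂ (ξ ω))) *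
        expNeg (∫⁻ y, f₃ y ∂(proj₃ (ξ ω))) =
      expNeg (∫⁻ y, (f₁ y.1.1 + f₂ y.1.2.1) ∂(ξ ω)) * expNeg (∫⁻ y, f₃ y ∂(proj₃ (ξ ω))) :=
    fun ω => by
      have m : Measurable fun y : Punctured (o₁, o₂, o₃) => f₁ y.1.1 := hf₁.comp measurable_coord₁
      rw [p₁, p₂, lintegral_add_left m, expNeg_add]
  have r : ∀ ω, axisFactor Λ (fun p => f₁ p.1) *
        expNeg (∫⁻ y, kernelExponent K (fun p => f₁ p.1) y ∂(proj₃ (ξ ω))) *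
        expNeg (∫⁻ y, f₂ y ∂(proj₂ (ξ ω))) * expNeg (∫⁻ y, f₃ y ∂(proj₃ (ξ ω))) =
      axisFactor Λ (fun p => f₁ p.1) * (expNeg (∫⁻ y, f₂ y.1.2.1 ∂(ξ ω)) *
        expNeg (∫⁻ y, (kernelExponent K (fun p => f₁ p.1) + f₃) y ∂(proj₃ (ξ ω)))) :=
    fun ω => by
      rw [p₂]
      simp only [Pi.add_apply]
      rw [lintegral_add_left hg, expNeg_add]
      ring
  simp_rw [l, r]
  have hm : Measurable fun ω => expNeg (∫⁻ y, f₂ y.1.2.1 ∂(ξ ω)) *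
      expNeg (∫⁻ y, (kernelExponent K (fun p => f₁ p.1) + f₃) y ∂(proj₃ (ξ ω))) :=
    ((measurable_expNeg_lintegral (hf₂.comp measurable_coord₂)).comp hξ.measurable).mul
      ((measurable_expNeg_lintegral (hg.add hf₃)).comp mZ)
  rw [lintegral_const_mul _ hm, L, R,
    axisFactor_add hΛ₁ hΛ₂ hnull]
  simp only [Pi.add_apply, kernelExponent_base, zero_add, expNeg_add, expNeg_kernelExponent,
    mul_assoc]
  congr 4
  refine lintegral_congr_ae ?_
  filter_upwards [hprod] with y₃ hy
  rw [Kernel.fst_apply, Kernel.snd_apply] at hy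
  have := lintegral_expNeg_add_of_prod hy hf₁ hf₂
  simp only [expNeg_add] at this
  rw [this]
  ring_nf

end ThirdProjection

/-! ### From conditional independence to independent kernels -/

/-- Bounded members of a countable algebra are closed under unions, so their complements form a
π-system. Complements are what is needed, since void probabilities of B₁ and B₂ evaluate K on B₁ᶜ ×
B₂ᶜ. The empty set is bounded, which puts `Set.univ` into the system. -/
lemma IsLocalizing.exists_piSystem {E : Type*} [MeasurableSpace E]
    [MeasurableSpace.CountablyGenerated E] {o : E} {L : ℕ → Set E} (hL : IsLocalizing o L) :
    ∃ C : Set (Set E), C.Countable ∧ IsPiSystem C ∧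
      MeasurableSpace.generateFrom C = ‹MeasurableSpace E› ∧ Set.univ ∈ C ∧
      ∀ B ∈ C, MeasurableSet B ∧ ∃ h, Bᶜ ⊆ L h := by
  set G := MeasurableSpace.countableGeneratingSet E ∪ Set.range L with hG
  set 𝒜 := generateSetAlgebra G with h𝒜
  have hcount : 𝒜.Countable := countable_generateSetAlgebra
    (MeasurableSpace.countable_countableGeneratingSet.union (Set.countable_range L))
  have halg : IsSetAlgebra 𝒜 := isSetAlgebra_generateSetAlgebra
  have hmeas : ∀ A ∈ 𝒜, MeasurableSet A := by
    intro A hA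
    have h1 : MeasurableSet[MeasurableSpace.generateFrom 𝒜] A :=
      MeasurableSpace.measurableSet_generateFrom hA
    rw [h𝒜, generateFrom_generateSetAlgebra_eq] at h1
    refine MeasurableSpace.generateFrom_le ?_ _ h1
    rintro s (hs | ⟨h, rfl⟩)
    · exact MeasurableSpace.measurableSet_countableGeneratingSet hs
    · exact hL.measurableSet h
  set C := compl '' {B ∈ 𝒜 | ∃ h, B ⊆ L h} with hC
  have hmem : ∀ B ∈ 𝒜, ∀ h, B ⊆ L h → Bᶜ ∈ C := fun B hB h hBh => ⟨B, ⟨hB, h, hBh⟩, rfl⟩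
  have hCm : ∀ B ∈ C, MeasurableSet B := by
    rintro _ ⟨B, ⟨hB, -⟩, rfl⟩
    exact (hmeas B hB).compl
  refine ⟨C, (hcount.mono fun B hB => hB.1).image _, ?_, ?_, ?_, ?_⟩
  · rintro _ ⟨B, ⟨hB, h, hBh⟩, rfl⟩ _ ⟨B', ⟨hB', h', hBh'⟩, rfl⟩ -
    rw [← Set.compl_union]
    refine hmem _ (halg.union_mem hB hB') (max h h') (Set.union_subset ?_ ?_)
    · exact hBh.trans (hL.mono (le_max_left _ _))
    · exact hBh'.trans (hL.mono (le_max_right _ _))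
  · refine le_antisymm (MeasurableSpace.generateFrom_le hCm) ?_
    have hin : ∀ B ∈ 𝒜, ∀ h, B ⊆ L h → MeasurableSet[MeasurableSpace.generateFrom C] B :=
      fun B hB h hBh => by
        have := @MeasurableSet.compl _ _ (MeasurableSpace.generateFrom C)
          (MeasurableSpace.measurableSet_generateFrom (hmem B hB h hBh))
        rwa [compl_compl] at this
    have hLm : ∀ h, L h ∈ 𝒜 := fun h => self_subset_generateSetAlgebra (Or.inr ⟨h, rfl⟩)
    -- Off o, a set is the union of its bounded pieces; the point o is then recovered by
    -- complementation.
    have hoff : ∀ A ∈ 𝒜, MeasurableSet[MeasurableSpace.generateFrom C] (A ∩ {y | y ≠ o}) := by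
      intro A hA
      rw [← hL.iUnion_eq, Set.inter_iUnion]
      exact MeasurableSet.iUnion fun h =>
        hin _ (halg.inter_mem hA (hLm h)) h Set.inter_subset_right
    have hpt : MeasurableSet[MeasurableSpace.generateFrom C] {y | y ≠ o} := by
      simpa using hoff Set.univ halg.univ_mem
    conv_lhs => rw [← MeasurableSpace.generateFrom_countableGeneratingSet (α := E)]
    refine MeasurableSpace.generateFrom_le fun A hA => ?_
    have hA' := hoff A (self_subset_generateSetAlgebra (Or.inl hA))
    by_cases ho : o ∈ A
    · have : A = A ∩ {y | y ≠ o} ∪ {y | y ≠ o}ᶜ := by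
        ext y
        by_cases hy : y = o
        · simp [hy, ho]
        · simp [hy]
      rw [this]
      exact @MeasurableSet.union _ (MeasurableSpace.generateFrom C) _ _ hA'
        (@MeasurableSet.compl _ _ (MeasurableSpace.generateFrom C) hpt)
    · have : A = A ∩ {y | y ≠ o} := by
        ext y
        by_cases hy : y = o
        · simp [hy, ho]
        · simp [hy]
      rw [this]
      exact hA'
  · simpa using hmem ∅ halg.empty_mem 0 (Set.empty_subset _)
  · rintro _ ⟨B, ⟨hB, h, hBh⟩, rfl⟩
    exact ⟨(hmeas B hB).compl, h, by simpa using hBh⟩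

/-! ### Void probabilities given the third projection -/

section ThirdProjection

variable {E₁ E₂ E₃ : Type*} [MeasurableSpace E₁] [MeasurableSpace E₂] [MeasurableSpace E₃]
  {o₁ : E₁} {o₂ : E₂} {o₃ : E₃} {K : Kernel (Punctured o₃) (E₁ × E₂)}
  {Λ : Measure (Punctured (o₁, o₂, o₃))}
  {Ω : Type*} [MeasurableSpace Ω] {μ : Measure Ω} [IsProbabilityMeasure μ]
  {ξ : Ω → Measure (Punctured (o₁, o₂, o₃))}

lemma measurableSet_first_second {D : Set (E₁ × E₂)} (hD : MeasurableSet D) :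
    MeasurableSet {y : Punctured (o₁, o₂, o₃) | (y.1.1, y.1.2.1) ∈ D} :=
  (measurable_coord₁.prodMk measurable_coord₂) hD

variable [MeasurableSingletonClass E₃]

lemma expNeg_indicator_top {α : Type*} (D : Set α) (x : α) :
    expNeg (D.indicator (fun _ => ∞) x) = Dᶜ.indicator 1 x := by
  by_cases h : x ∈ D <;> simp [h]

lemma lintegral_one_sub_expNeg_indicator_top {α : Type*} [MeasurableSpace α] {M : Measure α}
    {D : Set α} (hD : MeasurableSet D) :
    ∫⁻ x, (1 - expNeg (D.indicator (fun _ => ∞) x)) ∂M = M D := by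
  rw [← lintegral_indicator_one hD]
  refine lintegral_congr fun x => ?_
  by_cases h : x ∈ D <;> simp [h]

/-- The probability that there is no point with first two coordinates in `D`, conditionally on the
third projection. -/
theorem IsPoissonProcess.isCondProb_void (hξ : IsPoissonProcess ξ Λ μ) [SFinite (marginal₃ Λ)]
    (hΛ₃ : Λ {y | y.1.2.2 = o₃} = 0 ∨ Λ {y | y.1.2.2 = o₃} = ∞)
    (hK : IsDisintegration Λ K) {D : Set (E₁ × E₂)} (hD : MeasurableSet D) :
    IsCondProb μ (fun ω => proj₃ (ξ ω)) {ω | ξ ω {y | (y.1.1, y.1.2.1) ∈ D} = 0}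
      (fun ν => axisFactor Λ (D.indicator fun _ => ∞) *
        expNeg (∫⁻ z, kernelExponent K (D.indicator fun _ => ∞) z ∂ν)) := by
  have hF : Measurable (D.indicator fun _ => (∞ : ℝ≥0∞)) := measurable_const.indicator hD
  have hpair : Measurable fun y : Punctured (o₁, o₂, o₃) => (y.1.1, y.1.2.1) := by fun_prop
  have hg := measurable_kernelExponent (K := K) hF
  have mZ := measurable_proj₃.comp hξ.measurable
  have hw := (measurable_expNeg_lintegral hg).const_mul (axisFactor Λ (D.indicator fun _ => ∞))
  have hmeas : Measurable fun ω => ξ ω {y | (y.1.1, y.1.2.1) ∈ D} :=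
    (Measure.measurable_coe (measurableSet_first_second hD)).comp hξ.measurable
  have hA : MeasurableSet {ω | ξ ω {y | (y.1.1, y.1.2.1) ∈ D} = 0} :=
    hmeas (measurableSet_singleton 0)
  -- With the weight ∞ on D, exp(-ξF) is the indicator of the event without points in D.
  have hU : ∀ ω, expNeg (∫⁻ y, D.indicator (fun _ => ∞) (y.1.1, y.1.2.1) ∂(ξ ω)) =
      {ω | ξ ω {y | (y.1.1, y.1.2.1) ∈ D} = 0}.indicator 1 ω := fun ω => by
    have : (fun y : Punctured (o₁, o₂, o₃) =>
        D.indicator (fun _ => (∞ : ℝ≥0∞)) (y.1.1, y.1.2.1)) =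
        {y : Punctured (o₁, o₂, o₃) | (y.1.1, y.1.2.1) ∈ D}.indicator fun _ => ∞ := rfl
    rw [this, lintegral_indicator_const (measurableSet_first_second hD), expNeg_top_mul]
    simp [Set.indicator_apply]
  have hUm : Measurable fun ω =>
      expNeg (∫⁻ y, D.indicator (fun _ => ∞) (y.1.1, y.1.2.1) ∂(ξ ω)) :=
    (measurable_expNeg_lintegral (hF.comp hpair)).comp hξ.measurable
  have hUfin : ∫⁻ ω, expNeg (∫⁻ y, D.indicator (fun _ => ∞) (y.1.1, y.1.2.1) ∂(ξ ω)) ∂μ ≠ ∞ := by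
    refine ne_top_of_le_ne_top ?_ (lintegral_mono fun ω => expNeg_le_one _)
    simp
  have h := map_withDensity_eq_of_laplace mZ hUfin hUm (hw.comp mZ) fun f hf =>
    hξ.condLaplace_proj₃ hΛ₃ hK hF hf
  refine isCondProb_of_forall mZ hw fun C hC => ?_
  have h' := congrArg (fun P => P C) h
  simp only [Measure.map_apply mZ hC] at h'
  rw [withDensity_apply _ (mZ hC), withDensity_apply _ (mZ hC)] at h'
  refine Eq.trans ?_ h'
  simp_rw [hU]
  rw [lintegral_indicator_one hA, Measure.restrict_apply hA]
  rfl

omit [MeasurableSingletonClass E₃] in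
lemma axisFactor_indicator_top {D : Set (E₁ × E₂)} (hD : MeasurableSet D) :
    axisFactor Λ (D.indicator fun _ => ∞) =
      expNeg (Λ ({y | (y.1.1, y.1.2.1) ∈ D} ∩ {y | y.1.2.2 = o₃})) := by
  rw [axisFactor, ← Measure.restrict_apply (measurableSet_first_second hD),
    ← lintegral_one_sub_expNeg_indicator_top (measurableSet_first_second hD)]
  rfl

/-- Dropping the mass over o₃; this bounds the exponents for bounded sets. -/
lemma IsDisintegration.lintegral_kernel_le [SFinite (marginal₃ Λ)] (hK : IsDisintegration Λ K)
    {D : Set (E₁ × E₂)} (hD : MeasurableSet D) :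
    ∫⁻ y₃, K y₃ D ∂(marginal₃ Λ) ≤ Λ {y | (y.1.1, y.1.2.1) ∈ D} := by
  have hm := measurableSet_first_second (o₁ := o₁) (o₂ := o₂) (o₃ := o₃) hD
  have h := hK.lintegral_eq (measurable_one.indicator hm)
  rw [lintegral_indicator_one hm] at h
  rw [h]
  refine le_add_left (lintegral_mono fun y₃ => ?_)
  rw [← lintegral_indicator_one hD]
  exact le_rfl

/-- The consequence of conditional independence for the void probabilities of two rectangles. -/
theorem IsPoissonProcess.void_eq_of_condIndep (hξ : IsPoissonProcess ξ Λ μ)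
    [SFinite (marginal₃ Λ)]
    (hΛ₃ : Λ {y | y.1.2.2 = o₃} = 0 ∨ Λ {y | y.1.2.2 = o₃} = ∞)
    (hK : IsDisintegration Λ K)
    (hCI : CondIndep (fun ω => proj₁ (ξ ω)) (fun ω => proj₂ (ξ ω)) (fun ω => proj₃ (ξ ω)) μ)
    {B₁ : Set E₁} {B₂ : Set E₂} (hB₁ : MeasurableSet B₁) (hB₂ : MeasurableSet B₂)
    {C : Set (Punctured o₃)} (hC : MeasurableSet C) :
    Λ ({y | y.1.1 ∈ B₁ ∨ y.1.2.1 ∈ B₂} ∩ {y | y.1.2.2 = o₃}) +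
      ∫⁻ y₃, (1 - K y₃ (B₁ᶜ ×ˢ B₂ᶜ) * Cᶜ.indicator 1 y₃) ∂(marginal₃ Λ) =
    Λ ({y | y.1.1 ∈ B₁} ∩ {y | y.1.2.2 = o₃}) + Λ ({y | y.1.2.1 ∈ B₂} ∩ {y | y.1.2.2 = o₃}) +
      ∫⁻ y₃, (1 - K.fst y₃ B₁ᶜ * K.snd y₃ B₂ᶜ * Cᶜ.indicator 1 y₃) ∂(marginal₃ Λ) := by
  have := hK.1
  have mZ := measurable_proj₃.comp hξ.measurable
  set D₁ : Set (E₁ × E₂) := Prod.fst ⁻¹' B₁ with hD₁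
  set D₂ : Set (E₁ × E₂) := Prod.snd ⁻¹' B₂ with hD₂
  have mD₁ : MeasurableSet D₁ := measurable_fst hB₁
  have mD₂ : MeasurableSet D₂ := measurable_snd hB₂
  have mD := mD₁.union mD₂
  -- exp(-ξ₃f) indicates that ξ₃ has no point in C, and f(o₃) = 0 suppresses any term from o₃.
  set f : E₃ → ℝ≥0∞ := (Subtype.val '' C).indicator fun _ => ∞ with hf
  have mf : Measurable f :=
    measurable_const.indicator (measurableEmbedding_punctured.measurableSet_image' hC)
  have f0 : f o₃ = 0 := by
    refine Set.indicator_of_notMem ?_ _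
    rintro ⟨c, -, hc⟩
    exact c.2 hc
  have fC : ∀ y₃ : Punctured o₃, expNeg (f y₃.1) = Cᶜ.indicator 1 y₃ := fun y₃ => by
    rw [hf, expNeg_indicator_top]
    by_cases h : y₃ ∈ C <;> simp [h, Subtype.val_injective.mem_set_image]
  have hq : ∀ {D : Set (E₁ × E₂)} (_ : MeasurableSet D) (y₃ : Punctured o₃),
      ∫⁻ p, expNeg (D.indicator (fun _ => ∞) p) ∂(K y₃) = K y₃ Dᶜ := fun hD y₃ => by
    simp_rw [expNeg_indicator_top]
    rw [lintegral_indicator_one hD.compl]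
  have mI : ∀ {D : Set (E₁ × E₂)}, MeasurableSet D →
      Measurable (D.indicator fun _ => (∞ : ℝ≥0∞)) := fun hD => measurable_const.indicator hD
  have g₁ := measurable_kernelExponent (K := K) (mI mD₁)
  have g₂ := measurable_kernelExponent (K := K) (mI mD₂)
  -- the conditional probabilities
  have P₁ := hξ.isCondProb_void hΛ₃ hK mD₁
  have P₂ := hξ.isCondProb_void hΛ₃ hK mD₂
  have P := hξ.isCondProb_void hΛ₃ hK mD
  have mA : ∀ {D : Set (E₁ × E₂)}, MeasurableSet D →
      MeasurableSet {ω | ξ ω {y | (y.1.1, y.1.2.1) ∈ D} = 0} := fun hD =>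
    ((Measure.measurable_coe (measurableSet_first_second hD)).comp hξ.measurable)
      (measurableSet_singleton 0)
  have s₁ : {ω | ξ ω {y | (y.1.1, y.1.2.1) ∈ D₁} = 0} =
      (fun ω => proj₁ (ξ ω)) ⁻¹' {ν | ν B₁ = 0} := by
    ext ω
    change ξ ω _ = 0 ↔ proj₁ (ξ ω) B₁ = 0
    rw [proj₁, Measure.map_apply measurable_coord₁ hB₁]
    rfl
  have s₂ : {ω | ξ ω {y | (y.1.1, y.1.2.1) ∈ D₂} = 0} =
      (fun ω => proj₂ (ξ ω)) ⁻¹' {ν | ν B₂ = 0} := by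
    ext ω
    change ξ ω _ = 0 ↔ proj₂ (ξ ω) B₂ = 0
    rw [proj₂, Measure.map_apply measurable_coord₂ hB₂]
    rfl
  have s : {ω | ξ ω {y | (y.1.1, y.1.2.1) ∈ D₁ ∪ D₂} = 0} =
      {ω | ξ ω {y | (y.1.1, y.1.2.1) ∈ D₁} = 0} ∩ {ω | ξ ω {y | (y.1.1, y.1.2.1) ∈ D₂} = 0} := by
    ext ω
    exact measure_union_null_iff
  have hci := hCI {ν | ν B₁ = 0} {ν | ν B₂ = 0}
    (Measure.measurable_coe hB₁ (measurableSet_singleton 0))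
    (Measure.measurable_coe hB₂ (measurableSet_singleton 0))
  rw [← s₁, ← s₂, ← s] at hci
  -- No points in D₁ ∪ D₂ means no points in D₁ and none in D₂, so the conditional void
  -- probabilities multiply.
  have hae : ∀ᵐ ω ∂μ, axisFactor Λ ((D₁ ∪ D₂).indicator fun _ => ∞) *
        expNeg (∫⁻ z, kernelExponent K ((D₁ ∪ D₂).indicator fun _ => ∞) z ∂(proj₃ (ξ ω))) =
      axisFactor Λ (D₁.indicator fun _ => ∞) *
        expNeg (∫⁻ z, kernelExponent K (D₁.indicator fun _ => ∞) z ∂(proj₃ (ξ ω))) *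
      (axisFactor Λ (D₂.indicator fun _ => ∞) *
        expNeg (∫⁻ z, kernelExponent K (D₂.indicator fun _ => ∞) z ∂(proj₃ (ξ ω)))) := by
    filter_upwards [hci, P₁.condExp_ae_eq (mA mD₁) mZ, P₂.condExp_ae_eq (mA mD₂) mZ,
      P.condExp_ae_eq (mA mD) mZ] with ω h0 h1 h2 h3
    rw [Pi.mul_apply, h1, h2, h3, ← ENNReal.toReal_mul] at h0
    have fin : ∀ {F : E₁ × E₂ → ℝ≥0∞} {x : ℝ≥0∞}, axisFactor Λ F * expNeg x ≠ ∞ := fun {F x} =>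
      ENNReal.mul_ne_top (expNeg_ne_top _) (expNeg_ne_top _)
    exact (ENNReal.toReal_eq_toReal_iff' fin (ENNReal.mul_ne_top fin fin)).1 h0
  -- integration against the void indicator of the third projection
  have h1 := hξ.condLaplace_proj₃ hΛ₃ hK (mI mD) mf
  rw [hξ.laplace_proj₃ hΛ₃ hK (mI mD) mf] at h1
  have h2 := hξ.laplace_proj₃ hΛ₃ hK (F := fun _ => 0) measurable_const ((g₁.add g₂).add mf)
  have hsum : ∀ ω, axisFactor Λ (D₁.indicator fun _ => ∞) *
        expNeg (∫⁻ z, kernelExponent K (D₁.indicator fun _ => ∞) z ∂(proj₃ (ξ ω))) *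
      (axisFactor Λ (D₂.indicator fun _ => ∞) *
        expNeg (∫⁻ z, kernelExponent K (D₂.indicator fun _ => ∞) z ∂(proj₃ (ξ ω)))) *
        expNeg (∫⁻ z, f z ∂(proj₃ (ξ ω))) =
      axisFactor Λ (D₁.indicator fun _ => ∞) * axisFactor Λ (D₂.indicator fun _ => ∞) *
        expNeg (∫⁻ z, (kernelExponent K (D₁.indicator fun _ => ∞) +
          kernelExponent K (D₂.indicator fun _ => ∞) + f) z ∂(proj₃ (ξ ω))) := fun ω => by
    have e₁ := lintegral_add_left (μ := proj₃ (ξ ω)) (g₁.add g₂) f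
    have e₂ := lintegral_add_left (μ := proj₃ (ξ ω)) g₁
      (kernelExponent K (D₂.indicator fun _ => ∞))
    simp only [Pi.add_apply] at e₁ e₂ ⊢
    rw [e₁, e₂, expNeg_add, expNeg_add]
    ring
  have h3 : ∫⁻ ω, axisFactor Λ ((D₁ ∪ D₂).indicator fun _ => ∞) *
        expNeg (∫⁻ z, kernelExponent K ((D₁ ∪ D₂).indicator fun _ => ∞) z ∂(proj₃ (ξ ω))) *
        expNeg (∫⁻ z, f z ∂(proj₃ (ξ ω))) ∂μ =
      axisFactor Λ (D₁.indicator fun _ => ∞) * axisFactor Λ (D₂.indicator fun _ => ∞) *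
        ∫⁻ ω, expNeg (∫⁻ z, (kernelExponent K (D₁.indicator fun _ => ∞) +
          kernelExponent K (D₂.indicator fun _ => ∞) + f) z ∂(proj₃ (ξ ω))) ∂μ := by
    have hm : Measurable fun ω => expNeg (∫⁻ z, (kernelExponent K (D₁.indicator fun _ => ∞) +
          kernelExponent K (D₂.indicator fun _ => ∞) + f) z ∂(proj₃ (ξ ω))) :=
      (measurable_expNeg_lintegral ((g₁.add g₂).add mf)).comp mZ
    rw [← lintegral_const_mul _ hm]
    refine lintegral_congr_ae ?_
    filter_upwards [hae] with ω hω
    rw [hω, hsum]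
  rw [h3] at h1
  simp only [lintegral_zero, expNeg_zero, one_mul, lintegral_const, measure_univ,
    Pi.add_apply, kernelExponent_base, zero_add, f0, tsub_self, mul_one,
    expNeg_add, expNeg_kernelExponent, fC, hq mD₁, hq mD₂, hq mD] at h1 h2
  rw [h2] at h1
  simp only [axisFactor_indicator_top mD₁, axisFactor_indicator_top mD₂,
    axisFactor_indicator_top mD] at h1
  simp only [axisFactor, expNeg_zero, tsub_self, lintegral_zero, one_mul] at h1
  simp only [← expNeg_add] at h1
  have h4 := expNeg_injective h1
  have c₁ : ∀ y₃, K.fst y₃ B₁ᶜ = K y₃ D₁ᶜ := fun y₃ => Kernel.fst_apply' _ _ hB₁.compl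
  have c₂ : ∀ y₃, K.snd y₃ B₂ᶜ = K y₃ D₂ᶜ := fun y₃ => Kernel.snd_apply' _ _ hB₂.compl
  have c : (D₁ ∪ D₂)ᶜ = B₁ᶜ ×ˢ B₂ᶜ := by
    ext p
    simp [hD₁, hD₂]
  rw [c] at h4
  simp only [c₁, c₂]
  exact h4

/-- The identity for all C contains two unknown equalities. Subtracting it from the case C = ∅
isolates the kernels on C; afterwards the terms over o₃ remain. -/
theorem IsPoissonProcess.kernel_rect_of_condIndep (hξ : IsPoissonProcess ξ Λ μ)
    [SigmaFinite (marginal₃ Λ)]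
    (hΛ₃ : Λ {y | y.1.2.2 = o₃} = 0 ∨ Λ {y | y.1.2.2 = o₃} = ∞)
    (hK : IsDisintegration Λ K)
    (hCI : CondIndep (fun ω => proj₁ (ξ ω)) (fun ω => proj₂ (ξ ω)) (fun ω => proj₃ (ξ ω)) μ)
    {B₁ : Set E₁} {B₂ : Set E₂} (hB₁ : MeasurableSet B₁) (hB₂ : MeasurableSet B₂)
    (hfin₁ : Λ {y | y.1.1 ∈ B₁} < ∞) (hfin₂ : Λ {y | y.1.2.1 ∈ B₂} < ∞) :
    (∀ᵐ y₃ ∂(marginal₃ Λ), K y₃ (B₁ᶜ ×ˢ B₂ᶜ) = K.fst y₃ B₁ᶜ * K.snd y₃ B₂ᶜ) ∧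
      Λ {y | y.1.1 ∈ B₁ ∧ y.1.2.1 ∈ B₂ ∧ y.1.2.2 = o₃} = 0 := by
  have := hK.1
  set q := fun y₃ => K y₃ (B₁ᶜ ×ˢ B₂ᶜ) with hq
  set r := fun y₃ => K.fst y₃ B₁ᶜ * K.snd y₃ B₂ᶜ with hr
  have mq : Measurable q := K.measurable_coe (hB₁.compl.prod hB₂.compl)
  have mr : Measurable r :=
    (K.fst.measurable_coe hB₁.compl).mul (K.snd.measurable_coe hB₂.compl)
  set a := Λ ({y | y.1.1 ∈ B₁ ∨ y.1.2.1 ∈ B₂} ∩ {y | y.1.2.2 = o₃}) with ha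
  set b₁ := Λ ({y | y.1.1 ∈ B₁} ∩ {y | y.1.2.2 = o₃}) with hb₁
  set b₂ := Λ ({y | y.1.2.1 ∈ B₂} ∩ {y | y.1.2.2 = o₃}) with hb₂
  have split : ∀ (w : Punctured o₃ → ℝ≥0∞), ∀ C : Set (Punctured o₃), MeasurableSet C →
      ∫⁻ y₃, (1 - w y₃ * Cᶜ.indicator 1 y₃) ∂(marginal₃ Λ) =
        marginal₃ Λ C + ∫⁻ y₃ in Cᶜ, (1 - w y₃) ∂(marginal₃ Λ) := fun w C hC => by
    rw [← lintegral_indicator_one hC, ← lintegral_indicator hC.compl,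
      ← lintegral_add_left (measurable_one.indicator hC)]
    refine lintegral_congr fun y₃ => ?_
    by_cases h : y₃ ∈ C <;> simp [h]
  have key : ∀ C : Set (Punctured o₃), MeasurableSet C → marginal₃ Λ C < ∞ →
      a + ∫⁻ y₃ in Cᶜ, (1 - q y₃) ∂(marginal₃ Λ) =
        b₁ + b₂ + ∫⁻ y₃ in Cᶜ, (1 - r y₃) ∂(marginal₃ Λ) := fun C hC hfin => by
    have h := hξ.void_eq_of_condIndep hΛ₃ hK hCI hB₁ hB₂ hC
    rw [split q C hC, split r C hC, add_left_comm, add_left_comm (b₁ + b₂)] at h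
    exact (ENNReal.add_right_inj hfin.ne).1 h
  have hunion : Λ {y | y.1.1 ∈ B₁ ∨ y.1.2.1 ∈ B₂} < ∞ :=
    (measure_union_le _ _).trans_lt (ENNReal.add_lt_top.2 ⟨hfin₁, hfin₂⟩)
  have hafin : a < ∞ := (measure_mono Set.inter_subset_left).trans_lt hunion
  have hbfin : b₁ + b₂ ≠ ∞ := (ENNReal.add_lt_top.2
    ⟨(measure_mono Set.inter_subset_left).trans_lt hfin₁,
      (measure_mono Set.inter_subset_left).trans_lt hfin₂⟩).ne
  -- 1 - q is the K-mass of {y₁ ∈ B₁ or y₂ ∈ B₂}, whose Λ-mass is finite.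
  have hu : ∫⁻ y₃, (1 - q y₃) ∂(marginal₃ Λ) < ∞ := by
    have e : ∀ y₃, 1 - q y₃ = K y₃ (B₁ᶜ ×ˢ B₂ᶜ)ᶜ := fun y₃ =>
      (prob_compl_eq_one_sub (hB₁.compl.prod hB₂.compl)).symm
    simp_rw [e]
    refine (hK.lintegral_kernel_le (hB₁.compl.prod hB₂.compl).compl).trans_lt ?_
    refine (measure_mono fun y hy => ?_).trans_lt hunion
    by_contra hn
    exact hy (by simpa using hn)
  have hall := key ∅ MeasurableSet.empty (by simp)
  simp only [Set.compl_empty, Measure.restrict_univ] at hall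
  have hae : ∀ᵐ y₃ ∂(marginal₃ Λ), 1 - q y₃ = 1 - r y₃ := by
    refine ae_eq_of_forall_setLIntegral_eq_of_sigmaFinite (by fun_prop) (by fun_prop)
      fun C hC hfin => ?_
    have h := key C hC hfin
    -- Splitting the case C = ∅ over C and Cᶜ, the Cᶜ-part together with a, b₁, b₂ is the identity
    -- `h` and cancels.
    rw [← lintegral_add_compl _ hC, ← lintegral_add_compl (fun y₃ => 1 - r y₃) hC, add_left_comm,
      add_left_comm (b₁ + b₂), ← h] at hall
    refine (ENNReal.add_left_inj (ENNReal.add_lt_top.2 ⟨hafin, ?_⟩).ne).1 hall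
    exact (setLIntegral_le_lintegral _ _).trans_lt hu
  have hq1 : ∀ y₃, q y₃ ≤ 1 := fun y₃ => prob_le_one
  have hr1 : ∀ y₃, r y₃ ≤ 1 := fun y₃ => mul_le_one' prob_le_one prob_le_one
  refine ⟨?_, ?_⟩
  · filter_upwards [hae] with y₃ hy
    have h := congrArg (fun x => 1 - x) hy
    simpa only [ENNReal.sub_sub_cancel ENNReal.one_ne_top (hq1 y₃),
      ENNReal.sub_sub_cancel ENNReal.one_ne_top (hr1 y₃)] using h
  · rw [← lintegral_congr_ae hae] at hall
    -- With the kernel terms gone, a = b₁ + b₂; inclusion–exclusion then makes the intersection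
    -- null.
    have hab := (ENNReal.add_left_inj hu.ne).1 hall
    have mB₂ : MeasurableSet ({y : Punctured (o₁, o₂, o₃) | y.1.2.1 ∈ B₂} ∩ {y | y.1.2.2 = o₃}) :=
      (measurable_coord₂ hB₂).inter measurableSet_third
    have hie := measure_union_add_inter (μ := Λ)
      ({y : Punctured (o₁, o₂, o₃) | y.1.1 ∈ B₁} ∩ {y | y.1.2.2 = o₃}) mB₂
    rw [← Set.union_inter_distrib_right] at hie
    change a + _ = b₁ + b₂ at hie
    rw [hab] at hie
    have hz := (ENNReal.add_right_inj hbfin).1 (hie.trans (add_zero _).symm)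
    refine measure_mono_null (fun y hy => ?_) hz
    exact ⟨⟨hy.1, hy.2.2⟩, ⟨hy.2.1, hy.2.2⟩⟩

/-- Countability of the π-systems allows a single exceptional set for all rectangles, and the
rectangles determine the product. The null set is exhausted by L₁ h × L₂ h. -/
theorem IsPoissonProcess.kernel_of_condIndep [StandardBorelSpace E₁] [StandardBorelSpace E₂]
    {L₁ : ℕ → Set E₁} {L₂ : ℕ → Set E₂} {L₃ : ℕ → Set E₃}
    (hL₁ : IsLocalizing o₁ L₁) (hL₂ : IsLocalizing o₂ L₂)
    (hΛ_fin : ∀ h, Λ (localizingProd L₁ L₂ L₃ h) < ∞)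
    (hξ : IsPoissonProcess ξ Λ μ) [SigmaFinite (marginal₃ Λ)]
    (hΛ₃ : Λ {y | y.1.2.2 = o₃} = 0 ∨ Λ {y | y.1.2.2 = o₃} = ∞)
    (hK : IsDisintegration Λ K)
    (hCI : CondIndep (fun ω => proj₁ (ξ ω)) (fun ω => proj₂ (ξ ω)) (fun ω => proj₃ (ξ ω)) μ) :
    (∀ᵐ y₃ ∂(marginal₃ Λ), K y₃ = (K.fst y₃).prod (K.snd y₃)) ∧
      Λ {y | y.1.1 ≠ o₁ ∧ y.1.2.1 ≠ o₂ ∧ y.1.2.2 = o₃} = 0 := by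
  have := hK.1
  have fin₁ : ∀ {B : Set E₁} {h : ℕ}, B ⊆ L₁ h → Λ {y | y.1.1 ∈ B} < ∞ := fun {B h} hB =>
    lt_of_le_of_lt (measure_mono fun y hy => Or.inl (hB hy)) (hΛ_fin h)
  have fin₂ : ∀ {B : Set E₂} {h : ℕ}, B ⊆ L₂ h → Λ {y | y.1.2.1 ∈ B} < ∞ := fun {B h} hB =>
    lt_of_le_of_lt (measure_mono fun y hy => Or.inr (Or.inl (hB hy))) (hΛ_fin h)
  constructor
  · obtain ⟨C₁, cC₁, pC₁, gC₁, uC₁, hC₁⟩ := hL₁.exists_piSystem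
    obtain ⟨C₂, cC₂, pC₂, gC₂, uC₂, hC₂⟩ := hL₂.exists_piSystem
    have hall : ∀ᵐ y₃ ∂(marginal₃ Λ), ∀ B₁ ∈ C₁, ∀ B₂ ∈ C₂,
        K y₃ (B₁ ×ˢ B₂) = K.fst y₃ B₁ * K.snd y₃ B₂ := by
      refine (ae_ball_iff cC₁).2 fun B₁ hB₁ => (ae_ball_iff cC₂).2 fun B₂ hB₂ => ?_
      obtain ⟨m₁, h₁, l₁⟩ := hC₁ B₁ hB₁
      obtain ⟨m₂, h₂, l₂⟩ := hC₂ B₂ hB₂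
      simpa using (hξ.kernel_rect_of_condIndep hΛ₃ hK hCI m₁.compl m₂.compl (fin₁ l₁)
        (fin₂ l₂)).1
    filter_upwards [hall] with y₃ hy
    refine (Measure.prod_eq_generateFrom gC₁ gC₂ pC₁ pC₂
      ⟨fun _ => Set.univ, fun _ => uC₁, fun _ => measure_lt_top _ _, Set.iUnion_const _⟩
      ⟨fun _ => Set.univ, fun _ => uC₂, fun _ => measure_lt_top _ _, Set.iUnion_const _⟩ hy).symm
  · have hsub : {y : Punctured (o₁, o₂, o₃) | y.1.1 ≠ o₁ ∧ y.1.2.1 ≠ o₂ ∧ y.1.2.2 = o₃} ⊆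
        ⋃ h, {y | y.1.1 ∈ L₁ h ∧ y.1.2.1 ∈ L₂ h ∧ y.1.2.2 = o₃} := by
      rintro y ⟨h1, h2, h3⟩
      have h1' : y.1.1 ∈ ⋃ h, L₁ h := by rw [hL₁.iUnion_eq]; exact h1
      have h2' : y.1.2.1 ∈ ⋃ h, L₂ h := by rw [hL₂.iUnion_eq]; exact h2
      obtain ⟨n, hn⟩ := Set.mem_iUnion.1 h1'
      obtain ⟨m, hm⟩ := Set.mem_iUnion.1 h2'
      exact Set.mem_iUnion.2 ⟨max n m, hL₁.mono (le_max_left _ _) hn,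
        hL₂.mono (le_max_right _ _) hm, h3⟩
    refine measure_mono_null hsub (measure_iUnion_null fun h => ?_)
    exact (hξ.kernel_rect_of_condIndep hΛ₃ hK hCI (hL₁.measurableSet h) (hL₂.measurableSet h)
      (fin₁ subset_rfl) (fin₂ subset_rfl)).2

end ThirdProjection

/-! ### The representation by independent marks -/

section Representation

variable {E₁ E₂ E₃ : Type*} [MeasurableSpace E₁] [MeasurableSpace E₂] [MeasurableSpace E₃]
  [StandardBorelSpace E₁] [StandardBorelSpace E₂] [StandardBorelSpace E₃]
  {o₁ : E₁} {o₂ : E₂} {o₃ : E₃} {Λ : Measure (Punctured (o₁, o₂, o₃))}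

/-- A Markov kernel from the punctured space is the law of a measurable function of a uniform
variable, which may be prescribed at the removed point. -/
lemma exists_measurable_map_eq_kernel {E : Type*} [MeasurableSpace E] [StandardBorelSpace E]
    (o : E) (κ : Kernel (Punctured o₃) E) [IsMarkovKernel κ] :
    ∃ h : E₃ × I → E, Measurable h ∧ (∀ s, h (o₃, s) = o) ∧
      ∀ y₃ : Punctured o₃, (volume : Measure I).map (fun s => h (y₃.1, s)) = κ y₃ := by
  classical
  have : Nonempty E := ⟨o⟩
  obtain ⟨f, hf, hfκ⟩ := κ.exists_measurable_map_eq_unitInterval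
  have hg : Measurable fun p : ({p : E₃ × I | p.1 = o₃}ᶜ : Set (E₃ × I)) =>
      f ⟨p.1.1, p.2⟩ p.1.2 := by
    have : Measurable fun p : ({p : E₃ × I | p.1 = o₃}ᶜ : Set (E₃ × I)) =>
        ((⟨p.1.1, p.2⟩, p.1.2) : Punctured o₃ × I) :=
      (Measurable.subtype_mk measurable_subtype_coe.fst).prodMk measurable_subtype_coe.snd
    exact hf.comp this
  refine ⟨fun p => if hp : p ∈ {p : E₃ × I | p.1 = o₃} then o else f ⟨p.1, hp⟩ p.2,
    Measurable.dite (f := fun _ => o) measurable_const hg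
      (measurable_fst (measurableSet_singleton o₃)), fun s => ?_, fun y₃ => ?_⟩
  · simp
  · rw [← hfκ y₃]
    congr 1
    ext s
    exact dif_neg y₃.2

variable {Ω Ω' : Type*} [MeasurableSpace Ω] [MeasurableSpace Ω'] {μ : Measure Ω}
  [IsProbabilityMeasure μ] {μ' : Measure Ω'} [IsProbabilityMeasure μ']
  {ξ : Ω → Measure (Punctured (o₁, o₂, o₃))}
  {κ : Ω' → ℕ∞} {η : ℕ → Ω' → Punctured (o₁, o₂, o₃)} {θ₁ θ₂ : ℕ → Ω' → I}
  {h₁ : E₃ × I → E₁} {h₂ : E₃ × I → E₂}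

/-- The Laplace functional of the point process obtained from the extremally independent one. -/
theorem IsPoissonEnumeration.laplace_representPoint
    (hη : IsPoissonEnumeration κ η (extremalIndep Λ) μ')
    (hθ₁ : IsUniformSeq θ₁ μ') (hθ₂ : IsUniformSeq θ₂ μ')
    (hθ : IndepFun (fun ω i => θ₁ i ω) (fun ω i => θ₂ i ω) μ')
    (hηθ : IndepFun (fun ω => (κ ω, fun i => η i ω))
      (fun ω => (fun i => θ₁ i ω, fun i => θ₂ i ω)) μ')
    (m₁ : Measurable h₁) (m₂ : Measurable h₂)
    (hh₁ : ∀ s, h₁ (o₃, s) = o₁) (hh₂ : ∀ t, h₂ (o₃, t) = o₂)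
    {f : Punctured (o₁, o₂, o₃) → ℝ≥0∞} (hf : Measurable f) :
    ∫⁻ ω, expNeg (∫⁻ y, f y ∂(pointSum (κ ω) fun i =>
      representPoint h₁ h₂ hh₁ hh₂ (η i ω) (θ₁ i ω) (θ₂ i ω))) ∂μ' =
    expNeg (∫⁻ y in {y | y.1.2.1 = o₂ ∧ y.1.2.2 = o₃}, (1 - expNeg (f y)) ∂Λ +
      ∫⁻ y in {y | y.1.1 = o₁ ∧ y.1.2.2 = o₃}, (1 - expNeg (f y)) ∂Λ +
      ∫⁻ y₃, ∫⁻ p, (1 - expNeg (f (inclThird (p.1, p.2, y₃))))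
        ∂(representKernel o₃ m₁ m₂ y₃) ∂(marginal₃ Λ)) := by
  have hφ : Measurable fun y => 1 - expNeg (f y) := by fun_prop
  rw [← lintegral_extremalIndep_representPoint m₁ m₂ hh₁ hh₂ hφ]
  refine Eq.trans ?_
    (hη.laplace_marked hθ₁ hθ₂ hθ hηθ (hf.comp (measurable_representPoint m₁ m₂ hh₁ hh₂)))
  refine lintegral_congr fun ω => ?_
  rw [lintegral_pointSum _ _ hf]
  rfl

omit [IsProbabilityMeasure μ'] [StandardBorelSpace E₃] in
lemma measurable_representation (hη : IsPoissonEnumeration κ η (extremalIndep Λ) μ')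
    (hθ₁ : IsUniformSeq θ₁ μ') (hθ₂ : IsUniformSeq θ₂ μ')
    (m₁ : Measurable h₁) (m₂ : Measurable h₂)
    (hh₁ : ∀ s, h₁ (o₃, s) = o₁) (hh₂ : ∀ t, h₂ (o₃, t) = o₂) :
    Measurable fun ω => pointSum (κ ω) fun i =>
      representPoint h₁ h₂ hh₁ hh₂ (η i ω) (θ₁ i ω) (θ₂ i ω) :=
  measurable_pointSum hη.measurable_count fun i =>
    (measurable_representPoint m₁ m₂ hh₁ hh₂).comp ((hη.measurable_point i).prodMk
      ((hθ₁.measurable i).prodMk (hθ₂.measurable i)))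

omit [StandardBorelSpace E₁] [StandardBorelSpace E₂] [StandardBorelSpace E₃] in
lemma representKernel_eq_prod (m₁ : Measurable h₁) (m₂ : Measurable h₂) (y₃ : Punctured o₃) :
    representKernel o₃ m₁ m₂ y₃ =
      ((representKernel o₃ m₁ m₂).fst y₃).prod ((representKernel o₃ m₁ m₂).snd y₃) := by
  have : IsProbabilityMeasure ((volume : Measure I).map fun s => h₁ (y₃.1, s)) :=
    Measure.isProbabilityMeasure_map (by fun_prop)
  have : IsProbabilityMeasure ((volume : Measure I).map fun s => h₂ (y₃.1, s)) :=
    Measure.isProbabilityMeasure_map (by fun_prop)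
  rw [Kernel.fst_apply, Kernel.snd_apply, representKernel_apply]
  simp only [Measure.map_fst_prod, Measure.map_snd_prod, measure_univ, one_smul]

/-- Void probabilities determine the mean measure, including the value ∞, so Λ coincides with the
mean of the represented process. Testing with sets off {y₃ = o₃} gives the disintegration; testing
with the set off both axes over o₃ gives 0. -/
theorem isDisintegration_of_identDistrib (hξ : IsPoissonProcess ξ Λ μ)
    (hη : IsPoissonEnumeration κ η (extremalIndep Λ) μ')
    (hθ₁ : IsUniformSeq θ₁ μ') (hθ₂ : IsUniformSeq θ₂ μ')
    (hθ : IndepFun (fun ω i => θ₁ i ω) (fun ω i => θ₂ i ω) μ')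
    (hηθ : IndepFun (fun ω => (κ ω, fun i => η i ω))
      (fun ω => (fun i => θ₁ i ω, fun i => θ₂ i ω)) μ')
    (m₁ : Measurable h₁) (m₂ : Measurable h₂)
    (hh₁ : ∀ s, h₁ (o₃, s) = o₁) (hh₂ : ∀ t, h₂ (o₃, t) = o₂)
    (hid : IdentDistrib ξ (fun ω => pointSum (κ ω) fun i =>
      representPoint h₁ h₂ hh₁ hh₂ (η i ω) (θ₁ i ω) (θ₂ i ω)) μ μ') :
    IsDisintegration Λ (representKernel o₃ m₁ m₂) ∧
      Λ {y | y.1.1 ≠ o₁ ∧ y.1.2.1 ≠ o₂ ∧ y.1.2.2 = o₃} = 0 := by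
  have key : ∀ A : Set (Punctured (o₁, o₂, o₃)), MeasurableSet A → Λ A =
      Λ (A ∩ {y | y.1.2.1 = o₂ ∧ y.1.2.2 = o₃}) + Λ (A ∩ {y | y.1.1 = o₁ ∧ y.1.2.2 = o₃}) +
      ∫⁻ y₃, representKernel o₃ m₁ m₂ y₃ {p | inclThird (p.1, p.2, y₃) ∈ A} ∂(marginal₃ Λ) := by
    intro A hA
    have hf : Measurable (A.indicator fun _ => (∞ : ℝ≥0∞)) := measurable_const.indicator hA
    have h1 := hξ.laplace hf
    have h2 := hη.laplace_representPoint hθ₁ hθ₂ hθ hηθ m₁ m₂ hh₁ hh₂ hf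
    have h3 := (hid.comp (measurable_expNeg_lintegral hf)).lintegral_eq
    simp only [Function.comp_def] at h3
    rw [h1, h2] at h3
    have h4 := expNeg_injective h3
    have hin : ∀ y₃ : Punctured o₃, MeasurableSet
        {p : E₁ × E₂ | (inclThird (p.1, p.2, y₃) : Punctured (o₁, o₂, o₃)) ∈ A} := fun y₃ => by
      have : Measurable fun p : E₁ × E₂ =>
          (inclThird (p.1, p.2, y₃) : Punctured (o₁, o₂, o₃)) :=
        measurable_inclThird.comp (by fun_prop)
      exact this hA
    rw [lintegral_one_sub_expNeg_indicator_top hA, lintegral_one_sub_expNeg_indicator_top hA,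
      lintegral_one_sub_expNeg_indicator_top hA, Measure.restrict_apply hA,
      Measure.restrict_apply hA] at h4
    rw [h4]
    congr 1
    refine lintegral_congr fun y₃ => ?_
    exact lintegral_one_sub_expNeg_indicator_top (hin y₃)
  constructor
  · refine ⟨inferInstance, fun A hA => ?_⟩
    have hA' := measurableEmbedding_inclThird (o₁ := o₁) (o₂ := o₂) |>.measurableSet_image.2 hA
    rw [restrictThird, measurableEmbedding_inclThird.comap_apply, key _ hA']
    have e₁ : (inclThird '' A : Set (Punctured (o₁, o₂, o₃))) ∩
        {y | y.1.2.1 = o₂ ∧ y.1.2.2 = o₃} = ∅ := by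
      refine Set.eq_empty_of_forall_notMem ?_
      rintro _ ⟨⟨p, -, rfl⟩, -, h⟩
      exact p.2.2.2 h
    have e₂ : (inclThird '' A : Set (Punctured (o₁, o₂, o₃))) ∩
        {y | y.1.1 = o₁ ∧ y.1.2.2 = o₃} = ∅ := by
      refine Set.eq_empty_of_forall_notMem ?_
      rintro _ ⟨⟨p, -, rfl⟩, -, h⟩
      exact p.2.2.2 h
    rw [e₁, e₂, measure_empty, add_zero, zero_add]
    simp only [inclThird_injective.mem_set_image]
  · have hm : MeasurableSet {y : Punctured (o₁, o₂, o₃) |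
        y.1.1 ≠ o₁ ∧ y.1.2.1 ≠ o₂ ∧ y.1.2.2 = o₃} :=
      (measurable_coord₁ (measurableSet_singleton o₁)).compl.inter
        ((measurable_coord₂ (measurableSet_singleton o₂)).compl.inter measurableSet_third)
    rw [key _ hm]
    have e₁ : {y : Punctured (o₁, o₂, o₃) | y.1.1 ≠ o₁ ∧ y.1.2.1 ≠ o₂ ∧ y.1.2.2 = o₃} ∩
        {y | y.1.2.1 = o₂ ∧ y.1.2.2 = o₃} = ∅ :=
      Set.eq_empty_of_forall_notMem fun y hy => hy.1.2.1 hy.2.1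
    have e₂ : {y : Punctured (o₁, o₂, o₃) | y.1.1 ≠ o₁ ∧ y.1.2.1 ≠ o₂ ∧ y.1.2.2 = o₃} ∩
        {y | y.1.1 = o₁ ∧ y.1.2.2 = o₃} = ∅ :=
      Set.eq_empty_of_forall_notMem fun y hy => hy.1.1 hy.2.1
    have e₃ : ∀ y₃ : Punctured o₃, {p : E₁ × E₂ | (inclThird (p.1, p.2, y₃) :
        Punctured (o₁, o₂, o₃)) ∈ {y : Punctured (o₁, o₂, o₃) |
          y.1.1 ≠ o₁ ∧ y.1.2.1 ≠ o₂ ∧ y.1.2.2 = o₃}} = ∅ := fun y₃ =>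
      Set.eq_empty_of_forall_notMem fun p hp => y₃.2 hp.2.2
    simp only [e₁, e₂, e₃, measure_empty, lintegral_zero, add_zero]

/-- h₁ and h₂ realize the two marginals of K by uniform variables. Independent marks then produce
their product, which is K almost everywhere. -/
theorem exists_representation_of_kernel (hξ : IsPoissonProcess ξ Λ μ) [SFinite (marginal₃ Λ)]
    {K : Kernel (Punctured o₃) (E₁ × E₂)} (hK : IsDisintegration Λ K)
    (hprod : ∀ᵐ y₃ ∂(marginal₃ Λ), K y₃ = (K.fst y₃).prod (K.snd y₃))
    (hnull : Λ {y | y.1.1 ≠ o₁ ∧ y.1.2.1 ≠ o₂ ∧ y.1.2.2 = o₃} = 0)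
    (hη : IsPoissonEnumeration κ η (extremalIndep Λ) μ')
    (hθ₁ : IsUniformSeq θ₁ μ') (hθ₂ : IsUniformSeq θ₂ μ')
    (hθ : IndepFun (fun ω i => θ₁ i ω) (fun ω i => θ₂ i ω) μ')
    (hηθ : IndepFun (fun ω => (κ ω, fun i => η i ω))
      (fun ω => (fun i => θ₁ i ω, fun i => θ₂ i ω)) μ') :
    ∃ (h₁ : E₃ × I → E₁) (h₂ : E₃ × I → E₂) (_ : Measurable h₁) (_ : Measurable h₂)
      (hh₁ : ∀ s, h₁ (o₃, s) = o₁) (hh₂ : ∀ t, h₂ (o₃, t) = o₂),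
      IdentDistrib ξ (fun ω => pointSum (κ ω) (fun i =>
        representPoint h₁ h₂ hh₁ hh₂ (η i ω) (θ₁ i ω) (θ₂ i ω))) μ μ' := by
  have := hK.1
  obtain ⟨h₁, m₁, hh₁, law₁⟩ := exists_measurable_map_eq_kernel (o₃ := o₃) o₁ K.fst
  obtain ⟨h₂, m₂, hh₂, law₂⟩ := exists_measurable_map_eq_kernel (o₃ := o₃) o₂ K.snd
  refine ⟨h₁, h₂, m₁, m₂, hh₁, hh₂, identDistrib_of_laplace hξ.measurable
    (measurable_representation hη hθ₁ hθ₂ m₁ m₂ hh₁ hh₂) fun f hf => ?_⟩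
  rw [hξ.laplace hf, hη.laplace_representPoint hθ₁ hθ₂ hθ hηθ m₁ m₂ hh₁ hh₂ hf,
    hK.lintegral_eq (by fun_prop), setLIntegral_third_eq hnull]
  congr 2
  refine lintegral_congr_ae ?_
  filter_upwards [hprod] with y₃ hy
  rw [representKernel_apply, law₁, law₂, ← hy]

end Representation

end PoissonCI

end

/-! ### The equivalence of (a), (b) and (c) -/

theorem mainTheorem2
    {E₁ E₂ E₃ : Type*} [MeasurableSpace E₁] [MeasurableSpace E₂] [MeasurableSpace E₃]
    [StandardBorelSpace E₁] [StandardBorelSpace E₂] [StandardBorelSpace E₃]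
    (o₁ : E₁) (o₂ : E₂) (o₃ : E₃)
    (L₁ : ℕ → Set E₁) (L₂ : ℕ → Set E₂) (L₃ : ℕ → Set E₃)
    (hL₁ : PoissonCI.IsLocalizing o₁ L₁) (hL₂ : PoissonCI.IsLocalizing o₂ L₂)
    (hL₃ : PoissonCI.IsLocalizing o₃ L₃)
    (Λ : Measure (PoissonCI.Punctured (o₁, o₂, o₃)))
    (hΛ_fin : ∀ h, Λ (PoissonCI.localizingProd L₁ L₂ L₃ h) < ∞)
    (hΛ_inf : Λ Set.univ = ∞)
    (hΛ₁ : Λ {y | y.1.1 = o₁ ∧ y.1.2.2 = o₃} = 0 ∨ Λ {y | y.1.1 = o₁ ∧ y.1.2.2 = o₃} = ∞)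
    (hΛ₂ : Λ {y | y.1.2.1 = o₂ ∧ y.1.2.2 = o₃} = 0 ∨ Λ {y | y.1.2.1 = o₂ ∧ y.1.2.2 = o₃} = ∞)
    (hΛ₃ : Λ {y | y.1.2.2 = o₃} = 0 ∨ Λ {y | y.1.2.2 = o₃} = ∞)
    {Ω : Type*} [MeasurableSpace Ω] (μ : Measure Ω) [IsProbabilityMeasure μ]
    (ξ : Ω → Measure (PoissonCI.Punctured (o₁, o₂, o₃)))
    (hξ : PoissonCI.IsPoissonProcess ξ Λ μ) :
    -- (a) ↔ (b), for every version `K` of the conditional kernel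
    (∀ K : Kernel (PoissonCI.Punctured o₃) (E₁ × E₂), PoissonCI.IsDisintegration Λ K →
      (PoissonCI.CondIndep (fun ω => PoissonCI.proj₁ (ξ ω)) (fun ω => PoissonCI.proj₂ (ξ ω))
          (fun ω => PoissonCI.proj₃ (ξ ω)) μ ↔
        (∀ᵐ y₃ ∂(PoissonCI.marginal₃ Λ), K y₃ = (K.fst y₃).prod (K.snd y₃)) ∧
          Λ {y | y.1.1 ≠ o₁ ∧ y.1.2.1 ≠ o₂ ∧ y.1.2.2 = o₃} = 0)) ∧
    -- (a) ↔ (c), for every enumerated Poisson process with the mean measure in question and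
    -- every choice of the uniform randomizers
    (∀ {Ω' : Type*} [MeasurableSpace Ω'] (μ' : Measure Ω') [IsProbabilityMeasure μ']
      (κ : Ω' → ℕ∞) (η : ℕ → Ω' → PoissonCI.Punctured (o₁, o₂, o₃)) (θ₁ θ₂ : ℕ → Ω' → I),
      PoissonCI.IsPoissonEnumeration κ η (PoissonCI.extremalIndep Λ) μ' →
      PoissonCI.IsUniformSeq θ₁ μ' → PoissonCI.IsUniformSeq θ₂ μ' →
      IndepFun (fun ω i => θ₁ i ω) (fun ω i => θ₂ i ω) μ' →
      IndepFun (fun ω => (κ ω, fun i => η i ω))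
        (fun ω => (fun i => θ₁ i ω, fun i => θ₂ i ω)) μ' →
      (PoissonCI.CondIndep (fun ω => PoissonCI.proj₁ (ξ ω)) (fun ω => PoissonCI.proj₂ (ξ ω))
          (fun ω => PoissonCI.proj₃ (ξ ω)) μ ↔
        ∃ (h₁ : E₃ × I → E₁) (h₂ : E₃ × I → E₂) (_ : Measurable h₁) (_ : Measurable h₂)
          (hh₁ : ∀ s, h₁ (o₃, s) = o₁) (hh₂ : ∀ t, h₂ (o₃, t) = o₂),
          IdentDistrib ξ
            (fun ω => PoissonCI.pointSum (κ ω) (fun i =>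
              PoissonCI.representPoint h₁ h₂ hh₁ hh₂ (η i ω) (θ₁ i ω) (θ₂ i ω))) μ μ')) := by
  have := PoissonCI.sigmaFinite_marginal₃ hL₃ hΛ_fin
  refine ⟨fun K hK => ⟨fun hCI => hξ.kernel_of_condIndep hL₁ hL₂ hΛ_fin hΛ₃ hK hCI, fun h =>
    hξ.condIndep_of_kernel hΛ₁ hΛ₂ hΛ₃ hK h.1 h.2⟩, ?_⟩
  intro Ω' _ μ' _ κ η θ₁ θ₂ hη hθ₁ hθ₂ hθ hηθ
  constructor
  · intro hCI
    obtain ⟨K, hK⟩ := PoissonCI.exists_isDisintegration (Λ := Λ)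
    obtain ⟨hprod, hnull⟩ := hξ.kernel_of_condIndep hL₁ hL₂ hΛ_fin hΛ₃ hK hCI
    exact PoissonCI.exists_representation_of_kernel hξ hK hprod hnull hη hθ₁ hθ₂ hθ hηθ
  · rintro ⟨h₁, h₂, m₁, m₂, hh₁, hh₂, hid⟩
    -- The kernel built from h₁ and h₂ is itself a version of the conditional kernel and a product
    -- everywhere, so (b) holds for it.
    obtain ⟨hK, hnull⟩ := PoissonCI.isDisintegration_of_identDistrib hξ hη hθ₁ hθ₂ hθ hηθ m₁ m₂
      hh₁ hh₂ hid
    exact hξ.condIndep_of_kernel hΛ₁ hΛ₂ hΛ₃ hK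
      (ae_of_all _ fun y₃ => PoissonCI.representKernel_eq_prod m₁ m₂ y₃) hnull
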